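/- Let $G$ be a finite simple graph with maximum degree $\Delta$. A pebble distribution on $G$ is a function $P:V(G)\to\mathbb{Z}_{\ge 0}$, and sums of distributions are taken pointwise. A pebbling move removes two pebbles from a vertex that has at least two and adds one pebble to an adjacent vertex. A vertex $v$ is $k$-reachable under $P$ if some (possibly empty) sequence of pebbling moves, each executable when it is made, leads from $P$ to a distribution with at least $k$ pebbles on $v$; it is reachable if it is $1$-reachable. Let $\mathrm{reach}(P,v)$ be the greatest $k$ for which $v$ is $k$-reachable under $P$, let $\mathrm{exc}(P,v)=\mathrm{reach}(P,v)-1$ if $v$ is reachable under $P$ and $\mathrm{exc}(P,v)=0$ otherwise, and let $\mathrm{TE}(P)=\sum_{v\in V(G)}\mathrm{exc}(P,v)$. For distributions $P$ and $Q$ let $\mathrm{coop}(P,Q)$ be the number of vertices that are reachable under $P+Q$ but neither under $P$ nor under $Q$ (cooperation vertices), let $\mathrm{DC}(P,Q)$ be the number of vertices that are reachable under both $P$ and $Q$ (double covered vertices), and let $\mathrm{CE}(P,Q)=\mathrm{TE}(P+Q)-\mathrm{TE}(P)-\mathrm{TE}(Q)$ (cooperation excess). A unit is a distribution under which exactly one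 vertex has pebbles. **Lemma.** Let $P$ be a pebble distribution on $G$, and let $U$ be a unit that has at least two pebbles, all of them on the vertex $u$, where $P(u)=0$. Then $$\mathrm{coop}(P,U)-\mathrm{DC}(P,U)\le(\Delta-2)\,\mathrm{CE}(P,U).$$ -/

import Mathlib

namespace Pebbling

/-- A pebble distribution on the vertex set `V`. The sum of two distributions is the
pointwise sum. -/
abbrev Distribution (V : Type*) := V → ℕ

/-- The size of a distribution: the total number of pebbles. -/
def size {V : Type*} [Fintype V] (P : Distribution V) : ℕ := ∑ v, P v

/-- `Move G P P'`: the distribution `P'` arises from `P` by one pebbling move along an edge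
of `G`, which removes two pebbles from `u` and adds one pebble at its neighbour `v`. -/
def Move {V : Type*} (G : SimpleGraph V) (P P' : Distribution V) : Prop :=
  ∃ u v, G.Adj u v ∧ P u = P' u + 2 ∧ P' v = P v + 1 ∧ ∀ w, w ≠ u → w ≠ v → P' w = P w

/-- `P'` is obtained from `P` by a (possibly empty) executable sequence of pebbling moves. -/
def Obtainable {V : Type*} (G : SimpleGraph V) (P P' : Distribution V) : Prop :=
  Relation.ReflTransGen (Move G) P P'

/-- The vertex `v` is `k`-reachable under `P`. -/
def KReachable {V : Type*} (G : SimpleGraph V) (P : Distribution V) (k : ℕ) (v : V) : Prop :=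
  ∃ P', Obtainable G P P' ∧ k ≤ P' v

/-- The vertex `v` is reachable under `P`. -/
def Reachable {V : Type*} (G : SimpleGraph V) (P : Distribution V) (v : V) : Prop :=
  KReachable G P 1 v

/-- The greatest `k` such that `v` is `k`-reachable under `P`. -/
noncomputable def reach {V : Type*} (G : SimpleGraph V) (P : Distribution V) (v : V) : ℕ :=
  sSup {k | KReachable G P k v}

theorem Move.size_le {V : Type*} [Fintype V] {G : SimpleGraph V} {P P' : Distribution V}
    (h : Move G P P') : size P' ≤ size P := by
  classical
  obtain ⟨u, v, huv, hu, hv, hw⟩ := h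
  have hne : v ≠ u := huv.ne'
  have key : ∀ Q : Distribution V,
      size Q = Q u + (Q v + ∑ w ∈ (Finset.univ.erase u).erase v, Q w) := by
    intro Q
    rw [Finset.add_sum_erase _ _ (Finset.mem_erase.2 ⟨hne, Finset.mem_univ v⟩),
      Finset.add_sum_erase _ _ (Finset.mem_univ u), size]
  have hs : ∑ w ∈ (Finset.univ.erase u).erase v, P' w
      = ∑ w ∈ (Finset.univ.erase u).erase v, P w := by
    refine Finset.sum_congr rfl fun w h => ?_
    simp only [Finset.mem_erase, Finset.mem_univ, and_true] at h
    exact hw w h.2 h.1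
  rw [key P, key P', hs]
  omega

theorem Obtainable.size_le {V : Type*} [Fintype V] {G : SimpleGraph V} {P P' : Distribution V}
    (h : Obtainable G P P') : size P' ≤ size P := by
  induction h with
  | refl => exact le_rfl
  | tail _ h ih => exact h.size_le.trans ih

/-- On a finite graph the supremum in `reach` is a maximum. -/
theorem isGreatest_reach {V : Type*} [Fintype V] (G : SimpleGraph V) (P : Distribution V)
    (v : V) : IsGreatest {k | KReachable G P k v} (reach G P v) := by
  have hne : {k | KReachable G P k v}.Nonempty :=
    ⟨0, P, Relation.ReflTransGen.refl, Nat.zero_le _⟩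
  have hb : BddAbove {k | KReachable G P k v} := by
    refine ⟨size P, ?_⟩
    rintro k ⟨P', hP', hk⟩
    exact hk.trans ((Finset.single_le_sum (fun _ _ => Nat.zero_le _)
      (Finset.mem_univ v)).trans hP'.size_le)
  exact ⟨Nat.sSup_mem hne hb, fun k hk => le_csSup hb hk⟩

open Classical in
/-- The excess of the vertex `v` under `P`. -/
noncomputable def exc {V : Type*} (G : SimpleGraph V) (P : Distribution V) (v : V) : ℤ :=
  if Reachable G P v then (reach G P v : ℤ) - 1 else 0

/-- The total excess of `P`. -/
noncomputable def totalExcess {V : Type*} [Fintype V] (G : SimpleGraph V)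
    (P : Distribution V) : ℤ :=
  ∑ v, exc G P v

/-- The cooperation excess between `P` and `Q`. -/
noncomputable def coopExcess {V : Type*} [Fintype V] (G : SimpleGraph V)
    (P Q : Distribution V) : ℤ :=
  totalExcess G (P + Q) - (totalExcess G P + totalExcess G Q)

/-- A cooperation vertex of `P` and `Q`. -/
def IsCooperationVertex {V : Type*} (G : SimpleGraph V) (P Q : Distribution V) (v : V) : Prop :=
  ¬ Reachable G P v ∧ ¬ Reachable G Q v ∧ Reachable G (P + Q) v

/-- The number of cooperation vertices. -/
noncomputable def coop {V : Type*} (G : SimpleGraph V) (P Q : Distribution V) : ℕ :=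
  {v | IsCooperationVertex G P Q v}.ncard

/-- A double covered vertex of `P` and `Q`. -/
def IsDoubleCovered {V : Type*} (G : SimpleGraph V) (P Q : Distribution V) (v : V) : Prop :=
  Reachable G P v ∧ Reachable G Q v

/-- The number of double covered vertices. -/
noncomputable def doubleCovered {V : Type*} (G : SimpleGraph V) (P Q : Distribution V) : ℕ :=
  {v | IsDoubleCovered G P Q v}.ncard

/-- `U` is a unit on `u`: the vertex `u`, and no other vertex, has pebbles under `U`. -/
def IsUnitOn {V : Type*} (U : Distribution V) (u : V) : Prop :=
  ∀ v, 0 < U v ↔ v = u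

end Pebbling

/-! The order of moves is irrelevant up to cycles, so v is k-reachable exactly when some acyclic
flow collects k pebbles there, and flows can be truncated, cut and glued. Write E, C, D for
`gainSet`, `coopSet`, `doubleSet`. The cooperation excess is a sum of nonnegative local terms, at
least 1 on E and at least 3 on `richSet`, hence at least |E| + 2|richSet|.

For Δ ≥ 3, E is exhausted by growing sets S. The set `covered` is empty for S = ∅, contains C for S
= E, and should grow by at most Δ - 2 per new vertex. A vertex of E \ C adjacent to S achieves this,
and so does a cooperation vertex supplied by two vertices of S. With a single supplier the bound
fails by one; there are at most Δ - 1 ≤ 2(Δ - 2) such vertices per rich vertex, and the additional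
excess there pays for them. Opening a new block T of E \ C costs 2, repaid by double covered
vertices in T and by edges from T to vertices outside E ∪ C. That these number at least two is the
heart of the proof (`IsFirstGain.two_le`): otherwise T is entered along one edge only, and
recombining flows cut at this edge yields more pebbles than some value of `reach` permits.

For Δ = 2 the factor vanishes and |C| ≤ |D| is needed. Pebbles leave u along at most two arms and
halve at each step. The n pebbles of U reach log₂ n positions of an arm, and make up for about as
many positions that P leaves empty (`card_unreached_le`). So cooperation vertices far out are
balanced by double covered ones near u; a rounding exception is paid for by u itself or by an
additional double covered vertex. For Δ ≤ 1 reach is subadditive, which leaves no cooperation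
vertices and at most |D| excess. -/

namespace Pebbling

/-- There is no directed cycle of moves. -/
def Acyclic {V : Type*} (f : V → V → ℕ) : Prop := WellFounded fun a b => 0 < f a b

theorem Acyclic.mono {V : Type*} {f g : V → V → ℕ} (hf : Acyclic f) (h : g ≤ f) : Acyclic g :=
  Subrelation.wf (fun {a b} hab => lt_of_lt_of_le hab (h a b)) hf

theorem Acyclic.not_pos_symm {V : Type*} {f : V → V → ℕ} (hf : Acyclic f) {a b : V}
    (h : 0 < f a b) : f b a = 0 := by
  by_contra hc
  exact hf.asymmetric a b h (Nat.pos_of_ne_zero hc)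

/-! ### Flows: pebbling without order -/

section Flow

variable {V : Type*} [Fintype V]

/-- The number of moves of `f` that end at `v`. -/
def inflow (f : V → V → ℕ) (v : V) : ℕ := ∑ a, f a v

/-- The number of moves of `f` that start at `v`. -/
def outflow (f : V → V → ℕ) (v : V) : ℕ := ∑ b, f v b

/-- The number of all moves of `f`. -/
def totalFlow (f : V → V → ℕ) : ℕ := ∑ a, outflow f a

/-- A multiset of moves along edges of `G` (`f a b` moves from `a` to `b`) for which `P`
provides enough pebbles, if the order of the moves is disregarded. -/
structure IsFlow (G : SimpleGraph V) (P : Distribution V) (f : V → V → ℕ) : Prop where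
  adj : ∀ a b, 0 < f a b → G.Adj a b
  bal : ∀ a, 2 * outflow f a ≤ P a + inflow f a

theorem inflow_add (f g : V → V → ℕ) (v : V) : inflow (f + g) v = inflow f v + inflow g v := by
  simp [inflow, Finset.sum_add_distrib]

theorem outflow_add (f g : V → V → ℕ) (v : V) :
    outflow (f + g) v = outflow f v + outflow g v := by
  simp [outflow, Finset.sum_add_distrib]

theorem outflow_mono {f g : V → V → ℕ} (h : f ≤ g) (v : V) : outflow f v ≤ outflow g v :=
  Finset.sum_le_sum fun b _ => h v b

theorem totalFlow_add (f g : V → V → ℕ) : totalFlow (f + g) = totalFlow f + totalFlow g := by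
  simp [totalFlow, outflow_add, Finset.sum_add_distrib]

theorem totalFlow_eq_sum_inflow (f : V → V → ℕ) : totalFlow f = ∑ a, inflow f a :=
  Finset.sum_comm

theorem le_outflow (f : V → V → ℕ) (a b : V) : f a b ≤ outflow f a :=
  Finset.single_le_sum (f := fun b => f a b) (fun _ _ => Nat.zero_le _) (Finset.mem_univ b)

theorem exists_pos_of_inflow_pos {f : V → V → ℕ} {v : V} (h : 0 < inflow f v) :
    ∃ a, 0 < f a v := by
  by_contra! hc
  exact h.ne' (Finset.sum_eq_zero fun a _ => Nat.le_zero.1 (hc a))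

theorem exists_pos_of_outflow_pos {f : V → V → ℕ} {v : V} (h : 0 < outflow f v) :
    ∃ b, 0 < f v b := by
  by_contra! hc
  exact h.ne' (Finset.sum_eq_zero fun a _ => Nat.le_zero.1 (hc a))

/-- `k` moves from `u` to `v`. -/
def edgeFlow [DecidableEq V] (u v : V) (k : ℕ) : V → V → ℕ :=
  fun a b => if a = u ∧ b = v then k else 0

theorem inflow_edgeFlow [DecidableEq V] (u v : V) (k : ℕ) (a : V) :
    inflow (edgeFlow u v k) a = if a = v then k else 0 := by
  by_cases h : a = v <;> simp [inflow, edgeFlow, h]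

theorem outflow_edgeFlow [DecidableEq V] (u v : V) (k : ℕ) (a : V) :
    outflow (edgeFlow u v k) a = if a = u then k else 0 := by
  by_cases h : a = u <;> simp [outflow, edgeFlow, h]

theorem totalFlow_edgeFlow [DecidableEq V] (u v : V) (k : ℕ) :
    totalFlow (edgeFlow u v k) = k := by
  simp [totalFlow, outflow_edgeFlow]

variable {G : SimpleGraph V} {P : Distribution V} {f : V → V → ℕ}

theorem Obtainable.exists_flow {P' : Distribution V} (h : Obtainable G P P') :
    ∃ f : V → V → ℕ, (∀ a b, 0 < f a b → G.Adj a b) ∧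
      ∀ a, P' a + 2 * outflow f a = P a + inflow f a := by
  classical
  induction h with
  | refl => exact ⟨0, by simp, by simp [inflow, outflow]⟩
  | tail _ hm ih =>
    obtain ⟨f, hf, hb⟩ := ih
    obtain ⟨u, v, huv, hu, hv, hw⟩ := hm
    refine ⟨f + edgeFlow u v 1, fun a b hab => ?_, fun a => ?_⟩
    · by_cases h : a = u ∧ b = v
      · rw [h.1, h.2]; exact huv
      · exact hf a b (by simpa [edgeFlow, h] using hab)
    · rw [outflow_add, inflow_add, outflow_edgeFlow, inflow_edgeFlow]
      have hba := hb a
      by_cases h1 : a = u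
      · subst h1
        simp only [huv.ne, if_true, if_false]
        omega
      · by_cases h2 : a = v
        · subst h2
          simp only [h1, if_true, if_false]
          omega
        · have := hw a h1 h2
          simp only [h1, h2, if_false]
          omega

/-- The no-cycle lemma: the order of the moves does not matter. -/
theorem IsFlow.exists_obtainable (hf : IsFlow G P f) :
    ∃ P', Obtainable G P P' ∧ ∀ a, P a + inflow f a ≤ P' a + 2 * outflow f a := by
  classical
  induction hn : totalFlow f generalizing P f with
  | zero =>
    have h0 : ∀ a, inflow f a = 0 := by
      rw [totalFlow_eq_sum_inflow] at hn
      intro a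
      exact (Finset.sum_eq_zero_iff.1 hn) a (Finset.mem_univ a)
    exact ⟨P, Relation.ReflTransGen.refl, fun a => by simp [h0 a]⟩
  | succ n ih =>
    by_cases hex : ∃ u, 0 < outflow f u ∧ 2 ≤ P u
    · obtain ⟨u, hu, hPu⟩ := hex
      obtain ⟨v, hv⟩ := exists_pos_of_outflow_pos hu
      have huv := hf.adj u v hv
      obtain ⟨g, rfl⟩ : ∃ g, f = g + edgeFlow u v 1 := by
        refine ⟨f - edgeFlow u v 1, ?_⟩
        funext a b
        by_cases h : a = u ∧ b = v
        · obtain ⟨rfl, rfl⟩ := h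
          simp [edgeFlow]; omega
        · simp [edgeFlow, h]
      rw [totalFlow_add, totalFlow_edgeFlow] at hn
      let P₁ : Distribution V := fun a => if a = u then P a - 2 else if a = v then P a + 1 else P a
      have hb : ∀ a, P a + inflow (g + edgeFlow u v 1) a + 2 * outflow g a
          = P₁ a + inflow g a + 2 * outflow (g + edgeFlow u v 1) a := by
        intro a
        rw [inflow_add, outflow_add, inflow_edgeFlow, outflow_edgeFlow]
        by_cases h1 : a = u
        · subst h1
          simp only [P₁, huv.ne, if_true, if_false]; omega
        · by_cases h2 : a = v
          · simp only [P₁, h2, if_true, if_false, huv.ne']; omega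
          · simp only [P₁, h1, h2, if_false]; omega
      have hg : IsFlow G P₁ g := by
        refine ⟨fun a b hab => hf.adj a b (lt_of_lt_of_le hab (Nat.le_add_right _ _)), fun a => ?_⟩
        have h1 := hf.bal a
        have h2 := hb a
        omega
      obtain ⟨P', hP', hle⟩ := ih hg (by omega)
      refine ⟨P', Relation.ReflTransGen.head ⟨u, v, huv, ?_, ?_, ?_⟩ hP', fun a => ?_⟩
      · simp only [P₁, if_true]; omega
      · simp [P₁, huv.ne']
      · intro w h1 h2
        simp [P₁, h1, h2]
      · have h1 := hle a
        have h2 := hb a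
        omega
    -- When every vertex with outgoing moves has at most one pebble, the balance gives outflow ≤
    -- inflow everywhere. The totals agree, so equality holds and the remaining moves can be
    -- dropped.
    · push Not at hex
      have hin : ∀ a, outflow f a ≤ inflow f a := by
        intro a
        rcases Nat.eq_zero_or_pos (outflow f a) with h | h
        · omega
        · have h1 := hex a h
          have h2 := hf.bal a
          omega
      have heq : ∀ a, inflow f a = outflow f a := by
        have := (Finset.sum_eq_sum_iff_of_le (fun a _ => hin a)).1
          (totalFlow_eq_sum_inflow f)
        exact fun a => (this a (Finset.mem_univ a)).symm
      exact ⟨P, Relation.ReflTransGen.refl, fun a => by rw [heq a]; omega⟩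

/-- If there is a directed cycle, then there is a set of vertices on which predecessors can be
chosen injectively. -/
theorem exists_cycle_of_not_acyclic (h : ¬ Acyclic f) :
    ∃ (A : Finset V) (s : V → V), A.Nonempty ∧ (∀ b ∈ A, s b ∈ A ∧ 0 < f (s b) b) ∧
      Set.InjOn s A := by
  classical
  have hne : ∃ A : Finset V, A.Nonempty ∧ ∀ b ∈ A, ∃ a ∈ A, 0 < f a b := by
    -- The inaccessible vertices: each of them has an inaccessible predecessor.
    refine ⟨Finset.univ.filter fun a => ¬ Acc (fun a b => 0 < f a b) a, ?_, ?_⟩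
    · by_contra hc
      rw [Finset.not_nonempty_iff_eq_empty, Finset.filter_eq_empty_iff] at hc
      exact h ⟨fun a => not_not.1 (hc (Finset.mem_univ a))⟩
    · intro b hb
      simp only [Finset.mem_filter, Finset.mem_univ, true_and] at hb ⊢
      by_contra! hc
      refine hb ⟨_, fun a hab => ?_⟩
      by_contra hacc
      exact absurd hab (by have := hc a hacc; omega)
  obtain ⟨A, ⟨hA, hpred⟩, hmin⟩ :=
    WellFounded.has_min (wellFounded_lt (α := Finset V))
      {A | A.Nonempty ∧ ∀ b ∈ A, ∃ a ∈ A, 0 < f a b} hne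
  choose! s hs using hpred
  refine ⟨A, s, hA, hs, ?_⟩
  rw [← Finset.card_image_iff]
  -- The image of `s` inherits the property, so by minimality `s` maps `A` onto itself and is
  -- injective.
  have hsub : A.image s ⊆ A := Finset.image_subset_iff.2 fun b hb => (hs b hb).1
  have hmem : (A.image s).Nonempty ∧ ∀ b ∈ A.image s, ∃ a ∈ A.image s, 0 < f a b :=
    ⟨hA.image s, fun b hb => ⟨s b, Finset.mem_image_of_mem s (hsub hb), (hs b (hsub hb)).2⟩⟩
  have hnot := hmin _ hmem
  rw [(hsub.eq_or_ssubset).resolve_right hnot]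

/-- Removing a cycle takes one incoming and one outgoing move from each of its vertices, a net gain
of one pebble. The last clause says that no vertex ends with fewer pebbles. -/
theorem IsFlow.exists_acyclic (hf : IsFlow G P f) :
    ∃ g, g ≤ f ∧ IsFlow G P g ∧ Acyclic g ∧
      ∀ a, inflow f a + 2 * outflow g a ≤ inflow g a + 2 * outflow f a := by
  classical
  induction hn : totalFlow f using Nat.strong_induction_on generalizing f with
  | _ n ih =>
  by_cases hac : Acyclic f
  · exact ⟨f, le_rfl, hf, hac, fun a => le_rfl⟩
  obtain ⟨A, s, hA, hs, hinj⟩ := exists_cycle_of_not_acyclic hac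
  let c : V → V → ℕ := fun a b => if b ∈ A ∧ a = s b then 1 else 0
  have hcin : ∀ b, inflow c b = if b ∈ A then 1 else 0 := by
    intro b
    by_cases hb : b ∈ A <;> simp [inflow, c, hb]
  have hsurj : A.image s = A := by
    refine Finset.eq_of_subset_of_card_le (Finset.image_subset_iff.2 fun b hb => (hs b hb).1) ?_
    rw [Finset.card_image_of_injOn hinj]
  have hcout : ∀ a, outflow c a = if a ∈ A then 1 else 0 := by
    intro a
    by_cases ha : a ∈ A
    · rw [← hsurj, Finset.mem_image] at ha
      obtain ⟨b, hb, rfl⟩ := ha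
      have : ∀ b', (b' ∈ A ∧ s b = s b') ↔ b' = b :=
        fun b' => ⟨fun h => (hinj hb h.1 h.2).symm, fun h => by subst h; exact ⟨hb, rfl⟩⟩
      simp [outflow, c, this, (hs b hb).1]
    · rw [if_neg ha]
      refine Finset.sum_eq_zero fun b _ => if_neg fun h => ha ?_
      rw [h.2]; exact (hs b h.1).1
  have hle : c ≤ f := by
    intro a b
    by_cases h : b ∈ A ∧ a = s b
    · have := (hs b h.1).2
      simp only [c, h, and_self, if_true]
      omega
    · simp [c, h]
  obtain ⟨g, rfl⟩ : ∃ g, f = g + c := ⟨f - c, (tsub_add_cancel_of_le hle).symm⟩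
  have hg : IsFlow G P g := by
    refine ⟨fun a b hab => hf.adj a b (lt_of_lt_of_le hab (Nat.le_add_right _ _)), fun a => ?_⟩
    have := hf.bal a
    rw [outflow_add, inflow_add, hcin, hcout] at this
    split_ifs at this <;> omega
  have hpos : 0 < totalFlow c := by
    obtain ⟨a, ha⟩ := hA
    refine lt_of_lt_of_le ?_ (Finset.single_le_sum (f := outflow c) (fun _ _ => Nat.zero_le _)
      (Finset.mem_univ a))
    simp [hcout, ha]
  rw [totalFlow_add] at hn
  obtain ⟨g', hg'g, hg', hac', hfin⟩ := ih (totalFlow g) (by omega) hg rfl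
  refine ⟨g', hg'g.trans (by intro a b; simp), hg', hac', fun a => ?_⟩
  have := hfin a
  rw [inflow_add, outflow_add, hcin, hcout]
  split_ifs <;> omega

/-- The part of an acyclic flow that delivers pebbles to `x`. -/
theorem IsFlow.exists_to (hf : IsFlow G P f) (hac : Acyclic f) (x : V) :
    ∃ g, g ≤ f ∧ IsFlow G P g ∧ outflow g x = 0 ∧ inflow g x = inflow f x ∧
      totalFlow g + outflow f x ≤ totalFlow f ∧
      ∀ a, 0 < outflow g a → Relation.ReflTransGen (fun a b => 0 < f a b) a x := by
  classical
  let R : V → V → Prop := Relation.ReflTransGen fun a b => 0 < f a b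
  -- Only moves whose head still leads to `x` are kept. Acyclicity makes `x` a sink, and the moves
  -- saved there make the flow strictly smaller if `x` was passed through.
  let g : V → V → ℕ := fun a b => if R b x then f a b else 0
  have hle : g ≤ f := by
    intro a b
    by_cases h : R b x <;> simp [g, h]
  have hin : ∀ b, R b x → inflow g b = inflow f b := by
    intro b hb
    simp [inflow, g, hb]
  have hout : ∀ a, ¬ R a x → outflow g a = 0 := by
    intro a ha
    refine Finset.sum_eq_zero fun b _ => ?_
    by_contra hne
    have hb : R b x := by by_contra h; exact hne (by simp [g, h])
    have hfab : 0 < f a b := by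
      have : g a b = f a b := by simp [g, hb]
      omega
    exact ha (Relation.ReflTransGen.head hfab hb)
  have hx : outflow g x = 0 := by
    refine Finset.sum_eq_zero fun b _ => ?_
    by_contra hne
    have hb : R b x := by by_contra h; exact hne (by simp [g, h])
    have hfxb : 0 < f x b := by
      have : g x b = f x b := by simp [g, hb]
      omega
    have : Relation.TransGen (fun a b => 0 < f a b) x x := Relation.TransGen.head' hfxb hb
    exact (hac.transGen.irrefl).irrefl x this
  refine ⟨g, hle, ⟨fun a b hab => hf.adj a b (lt_of_lt_of_le hab (hle a b)), fun a => ?_⟩, hx,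
    hin x Relation.ReflTransGen.refl, ?_, fun a ha => by_contra fun h => ha.ne' (hout a h)⟩
  · by_cases ha : R a x
    · rw [hin a ha]
      exact (Nat.mul_le_mul_left 2 (outflow_mono hle a)).trans (hf.bal a)
    · rw [hout a ha]; omega
  · unfold totalFlow
    rw [← Finset.add_sum_erase _ _ (Finset.mem_univ x), hx, zero_add,
      ← Finset.add_sum_erase _ (outflow f) (Finset.mem_univ x), add_comm]
    exact Nat.add_le_add_left (Finset.sum_le_sum fun a _ => outflow_mono hle a) _

theorem IsFlow.add {Q : Distribution V} {g : V → V → ℕ} (hf : IsFlow G P f) (hg : IsFlow G Q g) :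
    IsFlow G (P + Q) (f + g) := by
  refine ⟨fun a b hab => ?_, fun a => ?_⟩
  · rcases Nat.eq_zero_or_pos (f a b) with h | h
    · exact hg.adj a b (by simpa [h] using hab)
    · exact hf.adj a b h
  · have h1 := hf.bal a
    have h2 := hg.bal a
    rw [outflow_add, inflow_add, Pi.add_apply]
    omega

theorem le_reach_iff {k : ℕ} {v : V} : k ≤ reach G P v ↔ KReachable G P k v := by
  refine ⟨fun h => ?_, fun h => (isGreatest_reach G P v).2 h⟩
  obtain ⟨P', h1, h2⟩ := (isGreatest_reach G P v).1
  exact ⟨P', h1, h.trans h2⟩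

theorem reachable_iff {v : V} : Reachable G P v ↔ 1 ≤ reach G P v := le_reach_iff.symm

theorem IsFlow.le_reach (hf : IsFlow G P f) {k : ℕ} {v : V}
    (h : k + 2 * outflow f v ≤ P v + inflow f v) : k ≤ reach G P v := by
  obtain ⟨P', h1, h2⟩ := hf.exists_obtainable
  exact le_reach_iff.2 ⟨P', h1, by have := h2 v; omega⟩

theorem le_reach (G : SimpleGraph V) (P : Distribution V) (v : V) : P v ≤ reach G P v :=
  le_reach_iff.2 ⟨P, Relation.ReflTransGen.refl, le_rfl⟩

/-- In an acyclic flow all pebbles that ever come to `x` can be collected there. -/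
theorem IsFlow.add_inflow_le_reach (hf : IsFlow G P f) (hac : Acyclic f) (x : V) :
    P x + inflow f x ≤ reach G P x := by
  obtain ⟨g, -, hg, h0, hin, -, -⟩ := hf.exists_to hac x
  exact hg.le_reach (by omega)

/-- The normal form used from here on: acyclic, with the target as a sink. -/
theorem exists_flow_of_le_reach {k : ℕ} {v : V} (h : k ≤ reach G P v) :
    ∃ f, IsFlow G P f ∧ Acyclic f ∧ outflow f v = 0 ∧ k ≤ P v + inflow f v := by
  obtain ⟨P', h1, h2⟩ := le_reach_iff.1 h
  obtain ⟨f, hf, hb⟩ := h1.exists_flow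
  have hfl : IsFlow G P f := ⟨hf, fun a => by have := hb a; omega⟩
  obtain ⟨g, -, hg, hac, hfin⟩ := hfl.exists_acyclic
  obtain ⟨g', hle, hg', h0, hin, -, -⟩ := hg.exists_to hac v
  refine ⟨g', hg', hac.mono hle, h0, ?_⟩
  have := hb v
  have := hfin v
  omega

theorem reach_add_le (G : SimpleGraph V) (P Q : Distribution V) (v : V) :
    reach G P v + reach G Q v ≤ reach G (P + Q) v := by
  obtain ⟨f, hf, -, hf0, hfk⟩ := exists_flow_of_le_reach (G := G) (P := P) (v := v) le_rfl
  obtain ⟨g, hg, -, hg0, hgk⟩ := exists_flow_of_le_reach (G := G) (P := Q) (v := v) le_rfl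
  refine (hf.add hg).le_reach ?_
  rw [outflow_add, inflow_add, Pi.add_apply]
  omega

theorem half_reach_le_of_adj {a b : V} (hab : G.Adj a b) :
    reach G P a / 2 ≤ reach G P b := by
  classical
  obtain ⟨f, hf, -, hf0, hfk⟩ := exists_flow_of_le_reach (G := G) (P := P) (v := a) le_rfl
  have hg : IsFlow G P (f + edgeFlow a b (reach G P a / 2)) := by
    refine ⟨fun x y hxy => ?_, fun x => ?_⟩
    · by_cases h : x = a ∧ y = b
      · rw [h.1, h.2]; exact hab
      · exact hf.adj x y (by simpa [edgeFlow, h] using hxy)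
    · have := hf.bal x
      rw [outflow_add, inflow_add, outflow_edgeFlow, inflow_edgeFlow]
      by_cases h : x = a
      · subst h
        rw [if_pos rfl]; omega
      · rw [if_neg h]; omega
  refine hg.le_reach ?_
  have := hf.bal b
  rw [outflow_add, inflow_add, outflow_edgeFlow, inflow_edgeFlow, if_neg hab.ne', if_pos rfl]
  omega

theorem exists_adj_of_reach_pos {v : V} (h : 1 ≤ reach G P v) (hv : P v = 0) :
    ∃ x, G.Adj x v ∧ 2 ≤ reach G P x := by
  obtain ⟨f, hf, hac, -, hk⟩ := exists_flow_of_le_reach h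
  obtain ⟨x, hx⟩ := exists_pos_of_inflow_pos (f := f) (v := v) (by omega)
  refine ⟨x, hf.adj x v hx, ?_⟩
  have h1 := hf.bal x
  have h2 := le_outflow f x v
  have h3 := hf.add_inflow_le_reach hac x
  omega

/-- Truncating `reach` below at 1 absorbs the unreachable case. -/
theorem exc_eq (G : SimpleGraph V) (P : Distribution V) (v : V) :
    exc G P v = (max (reach G P v) 1 : ℕ) - 1 := by
  unfold exc
  by_cases h : 1 ≤ reach G P v
  · rw [if_pos (reachable_iff.2 h), max_eq_left h]
  · rw [if_neg (fun hr => h (reachable_iff.1 hr)), max_eq_right (by omega)]; simp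

end Flow

end Pebbling

namespace Pebbling

/-! ### Exhausting the gain set -/

section Counting

open Classical

variable {V : Type*} [Fintype V] (G : SimpleGraph V) (E C : Finset V)

/-- The neighbours of `v`. -/
noncomputable def nbrs (v : V) : Finset V := Finset.univ.filter (G.Adj v)

/-- The neighbours of `v` outside `E ∪ C`. -/
noncomputable def outerNbrs (v : V) : Finset V := nbrs G v \ (E ∪ C)

/-- The vertices of `E ∪ C` that are in `S` or adjacent to it, without those of `S \ C`. -/
noncomputable def covered (S : Finset V) : Finset V :=
  Finset.univ.filter fun x =>
    (x ∈ E ∨ x ∈ C) ∧ (x ∈ S ∨ ∃ s ∈ S, G.Adj s x) ∧ ¬ (x ∈ S ∧ x ∉ C)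

variable {G E C} {Δ : ℕ} {S : Finset V} {v : V}

theorem mem_nbrs {x : V} : x ∈ nbrs G v ↔ G.Adj v x := by simp [nbrs]

theorem mem_outerNbrs {x : V} : x ∈ outerNbrs G E C v ↔ G.Adj v x ∧ x ∉ E ∧ x ∉ C := by
  simp [outerNbrs, mem_nbrs]

theorem mem_covered {x : V} : x ∈ covered G E C S ↔
    (x ∈ E ∨ x ∈ C) ∧ (x ∈ S ∨ ∃ s ∈ S, G.Adj s x) ∧ ¬ (x ∈ S ∧ x ∉ C) := by
  simp [covered]

theorem card_inter_add_card_outerNbrs_le (hΔ : (nbrs G v).card ≤ Δ) :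
    (nbrs G v ∩ (E ∪ C)).card + (outerNbrs G E C v).card ≤ Δ := by
  rw [outerNbrs, Finset.card_inter_add_card_sdiff]
  exact hΔ

theorem covered_insert_subset (hvC : v ∉ C) :
    covered G E C (insert v S) ⊆ covered G E C S ∪ (nbrs G v ∩ (E ∪ C)) := by
  intro x hx
  simp only [mem_covered, Finset.mem_insert, Finset.mem_union, Finset.mem_inter, mem_nbrs] at hx ⊢
  obtain ⟨h1, h2, h3⟩ := hx
  have hxv : x ≠ v := fun h => h3 ⟨Or.inl h, h ▸ hvC⟩
  rcases h2 with (h | h) | ⟨s, rfl | hs, ha⟩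
  · exact absurd h hxv
  · exact Or.inl ⟨h1, Or.inl h, fun hc => h3 ⟨Or.inr hc.1, hc.2⟩⟩
  · exact Or.inr ⟨ha, h1⟩
  · exact Or.inl ⟨h1, Or.inr ⟨s, hs, ha⟩, fun hc => h3 ⟨Or.inr hc.1, hc.2⟩⟩

theorem card_covered_insert (hΔ : (nbrs G v).card ≤ Δ) (hvC : v ∉ C) :
    (covered G E C (insert v S)).card + (outerNbrs G E C v).card
      ≤ (covered G E C S).card + Δ := by
  have h1 := (Finset.card_le_card (covered_insert_subset (G := G) (E := E) (S := S) hvC)).trans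
    (Finset.card_union_le _ _)
  have h2 := card_inter_add_card_outerNbrs_le (E := E) (C := C) hΔ
  omega

/-- Two are saved: `v` was covered and leaves, and its neighbour `s` in `S` is no new covered
vertex. -/
theorem card_covered_insert_of_adj (hΔ : (nbrs G v).card ≤ Δ) (hSE : S ⊆ E) (hvE : v ∈ E)
    (hvC : v ∉ C) (hvS : v ∉ S) {s : V} (hs : s ∈ S) (hsv : G.Adj s v) :
    (covered G E C (insert v S)).card + 2 + (outerNbrs G E C v).card
      ≤ (covered G E C S).card + Δ := by
  have hv : v ∈ covered G E C S :=
    mem_covered.2 ⟨Or.inl hvE, Or.inr ⟨s, hs, hsv⟩, fun h => hvS h.1⟩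
  have hsub : covered G E C (insert v S)
      ⊆ (covered G E C S).erase v ∪ (nbrs G v ∩ (E ∪ C)).erase s := by
    intro x hx
    have hxv : x ≠ v := by
      rintro rfl
      exact (mem_covered.1 hx).2.2 ⟨Finset.mem_insert_self _ _, hvC⟩
    by_cases hxS : x ∈ covered G E C S
    · exact Finset.mem_union_left _ (Finset.mem_erase.2 ⟨hxv, hxS⟩)
    · refine Finset.mem_union_right _ (Finset.mem_erase.2 ⟨?_, ?_⟩)
      · rintro rfl
        refine hxS (mem_covered.2 ⟨Or.inl (hSE hs), Or.inl hs, fun h => ?_⟩)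
        exact (mem_covered.1 hx).2.2 ⟨Finset.mem_insert_of_mem h.1, h.2⟩
      · exact (Finset.mem_union.1 (covered_insert_subset hvC hx)).resolve_left hxS
  have hsm : s ∈ nbrs G v ∩ (E ∪ C) :=
    Finset.mem_inter.2 ⟨mem_nbrs.2 hsv.symm, Finset.mem_union_left _ (hSE hs)⟩
  have h1 := (Finset.card_le_card hsub).trans (Finset.card_union_le _ _)
  rw [Finset.card_erase_of_mem hv, Finset.card_erase_of_mem hsm] at h1
  have h2 := card_inter_add_card_outerNbrs_le (E := E) (C := C) hΔ
  have h3 := Finset.card_pos.2 ⟨v, hv⟩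
  have h4 := Finset.card_pos.2 ⟨s, hsm⟩
  omega

/-- `v` is already covered through `A`, and the vertices of `A`, lying in `S`, are not newly
covered. -/
theorem card_covered_insert_of_mem (hΔ : (nbrs G v).card ≤ Δ) (hvC : v ∈ C)
    {A : Finset V} (hA : A ⊆ nbrs G v ∩ S) (hne : A.Nonempty) :
    (covered G E C (insert v S)).card + A.card ≤ (covered G E C S).card + Δ := by
  have hadj : ∀ a ∈ A, a ∈ S ∧ G.Adj v a := fun a ha => by
    have := Finset.mem_inter.1 (hA ha)
    exact ⟨this.2, mem_nbrs.1 this.1⟩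
  have hsub : covered G E C (insert v S) ⊆ covered G E C S ∪ (nbrs G v \ A) := by
    intro x hx
    obtain ⟨h1, h2, h3⟩ := mem_covered.1 hx
    rw [Finset.mem_union]
    by_cases hxv : x = v
    · subst hxv
      obtain ⟨a, ha⟩ := hne
      exact Or.inl (mem_covered.2
        ⟨h1, Or.inr ⟨a, (hadj a ha).1, (hadj a ha).2.symm⟩, fun h => h.2 hvC⟩)
    · by_cases hx' : x ∈ S ∨ ∃ s ∈ S, G.Adj s x
      · exact Or.inl (mem_covered.2 ⟨h1, hx', fun h => h3 ⟨Finset.mem_insert_of_mem h.1, h.2⟩⟩)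
      · refine Or.inr (Finset.mem_sdiff.2 ⟨?_, fun hxA => hx' (Or.inl (hadj x hxA).1)⟩)
        rcases h2 with h | ⟨s, hs, ha⟩
        · exact absurd (Or.inl ((Finset.mem_insert.1 h).resolve_left hxv)) hx'
        · rcases Finset.mem_insert.1 hs with rfl | hs
          · exact mem_nbrs.2 ha
          · exact absurd (Or.inr ⟨s, hs, ha⟩) hx'
  have h1 := (Finset.card_le_card hsub).trans (Finset.card_union_le _ _)
  rw [Finset.card_sdiff_of_subset (hA.trans Finset.inter_subset_left)] at h1
  have := Finset.card_le_card (hA.trans Finset.inter_subset_left)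
  omega

/-- A set `T ⊆ E \ C` that is closed under adjacency in `E \ C`. -/
def IsBlock (G : SimpleGraph V) (E C T : Finset V) : Prop :=
  (∀ x ∈ T, x ∈ E ∧ x ∉ C) ∧ ∀ x ∈ T, ∀ y, G.Adj x y → y ∈ E → y ∉ C → y ∈ T

/-- A maximal set grown from `v`. The first vertex saves nothing, whence the `+ 2`; each later one
is adjacent to an earlier one and saves two. -/
theorem exists_block (hΔ : ∀ v, (nbrs G v).card ≤ Δ) (hSE : S ⊆ E)
    (hS : ∀ x ∈ E, x ∉ C → x ∉ S → ∀ s ∈ S, ¬ G.Adj s x) (hvE : v ∈ E) (hvC : v ∉ C)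
    (hvS : v ∉ S) :
    ∃ T, v ∈ T ∧ IsBlock G E C T ∧ Disjoint S T ∧
      (covered G E C (S ∪ T)).card + ∑ x ∈ T, (outerNbrs G E C x).card + 2 * T.card
        ≤ (covered G E C S).card + Δ * T.card + 2 := by
  let F : Finset (Finset V) := Finset.univ.filter fun T =>
    v ∈ T ∧ (∀ x ∈ T, x ∈ E ∧ x ∉ C ∧ x ∉ S) ∧
      (covered G E C (S ∪ T)).card + ∑ x ∈ T, (outerNbrs G E C x).card + 2 * T.card
        ≤ (covered G E C S).card + Δ * T.card + 2
  have hF : F.Nonempty := by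
    refine ⟨{v}, Finset.mem_filter.2 ⟨Finset.mem_univ _, Finset.mem_singleton_self v, ?_, ?_⟩⟩
    · intro x hx
      rw [Finset.mem_singleton.1 hx]
      exact ⟨hvE, hvC, hvS⟩
    · have := card_covered_insert (E := E) (S := S) (hΔ v) hvC
      rw [Finset.union_comm, ← Finset.insert_eq]
      simp only [Finset.sum_singleton, Finset.card_singleton]
      omega
  obtain ⟨T, hT, hmax⟩ := Finset.exists_max_image F Finset.card hF
  obtain ⟨-, hvT, hTE, hcard⟩ := Finset.mem_filter.1 hT
  refine ⟨T, hvT, ⟨fun x hx => ⟨(hTE x hx).1, (hTE x hx).2.1⟩, ?_⟩,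
    Finset.disjoint_right.2 fun x hx => (hTE x hx).2.2, hcard⟩
  intro x hx y hxy hyE hyC
  by_contra hyT
  have hyS : y ∉ S := fun h => hS x (hTE x hx).1 (hTE x hx).2.1 (hTE x hx).2.2 y h hxy.symm
  have hsub : S ∪ T ⊆ E := Finset.union_subset hSE fun z hz => (hTE z hz).1
  have h1 := card_covered_insert_of_adj (hΔ y) hsub hyE hyC (by simp [hyS, hyT])
    (Finset.mem_union_right S hx) hxy
  have hmem : insert y T ∈ F := by
    refine Finset.mem_filter.2 ⟨Finset.mem_univ _, Finset.mem_insert_of_mem hvT, ?_, ?_⟩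
    · intro z hz
      rcases Finset.mem_insert.1 hz with rfl | hz
      · exact ⟨hyE, hyC, hyS⟩
      · exact hTE z hz
    · rw [Finset.union_insert, Finset.sum_insert hyT, Finset.card_insert_of_notMem hyT, mul_add Δ]
      omega
  have := hmax _ hmem
  rw [Finset.card_insert_of_notMem hyT] at this
  omega

/-- A set `E` can be built up from blocks and from single vertices that are adjacent to what
is already there, and `covered G E C` grows in a controlled way. -/
theorem card_covered_le (D B : Finset V) (hΔ : ∀ v, (nbrs G v).card ≤ Δ)
    (hstep : ∀ S, S ⊆ E → S ≠ E → (∀ x ∈ E, x ∉ C → x ∉ S → ∀ s ∈ S, ¬ G.Adj s x) →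
      ∃ v ∈ E, v ∉ S ∧
        ((v ∈ C ∧ ∃ A ⊆ nbrs G v ∩ S, A.Nonempty ∧ (2 ≤ A.card ∨ v ∈ B)) ∨
          (v ∉ C ∧ ∀ T, v ∈ T → IsBlock G E C T → Disjoint S T →
            2 ≤ (D ∩ T).card + ∑ x ∈ T, (outerNbrs G E C x).card))) :
    (covered G E C E).card + 2 * E.card ≤ Δ * E.card + (D ∩ E).card + (B ∩ E).card := by
  -- A largest `S` satisfying the bound must be `E`, since otherwise `hstep` enlarges it.
  let F : Finset (Finset V) := E.powerset.filter fun S =>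
    (covered G E C S).card + 2 * S.card ≤ Δ * S.card + (D ∩ S).card + (B ∩ S).card
  have hF : F.Nonempty :=
    ⟨∅, Finset.mem_filter.2 ⟨Finset.empty_mem_powerset _, by simp [covered]⟩⟩
  obtain ⟨S, hSF, hmax⟩ := Finset.exists_max_image F Finset.card hF
  obtain ⟨hSE, hcard⟩ := Finset.mem_filter.1 hSF
  rw [Finset.mem_powerset] at hSE
  have hgrow : ∀ T, T ⊆ E → T.Nonempty → Disjoint S T →
      ¬ ((covered G E C (S ∪ T)).card + 2 * T.card
        ≤ (covered G E C S).card + Δ * T.card + (D ∩ T).card + (B ∩ T).card) := by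
    intro T hTE hT hdis hle
    have hi : ∀ X : Finset V, (X ∩ (S ∪ T)).card = (X ∩ S).card + (X ∩ T).card := by
      intro X
      rw [Finset.inter_union_distrib_left, Finset.card_union_of_disjoint]
      exact hdis.mono Finset.inter_subset_right Finset.inter_subset_right
    have := hmax (S ∪ T) (Finset.mem_filter.2
      ⟨Finset.mem_powerset.2 (Finset.union_subset hSE hTE), by
        rw [hi, hi, Finset.card_union_of_disjoint hdis, mul_add Δ]; omega⟩)
    rw [Finset.card_union_of_disjoint hdis] at this
    have := Finset.card_pos.2 hT
    omega
  by_cases hS : S = E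
  · rwa [hS] at hcard
  exfalso
  have hsingle : ∀ v ∈ E, v ∉ S → ¬ ((covered G E C (insert v S)).card + 2
        ≤ (covered G E C S).card + Δ + (D ∩ {v}).card + (B ∩ {v}).card) := by
    intro v hv hvS hle
    refine hgrow {v} (by simpa using hv) (by simp) (by simpa using hvS) ?_
    rw [Finset.union_comm, ← Finset.insert_eq]
    simpa using hle
  have hadj : ∀ x ∈ E, x ∉ C → x ∉ S → ∀ s ∈ S, ¬ G.Adj s x := by
    intro x hx hxC hxS s hs hsx
    have := card_covered_insert_of_adj (hΔ x) hSE hx hxC hxS hs hsx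
    exact hsingle x hx hxS (by omega)
  obtain ⟨v, hvE, hvS, ⟨hvC, A, hA, hne, hor⟩ | ⟨hvC, hT⟩⟩ := hstep S hSE hS hadj
  · have h1 := card_covered_insert_of_mem (E := E) (hΔ v) hvC hA hne
    have h2 := Finset.card_pos.2 hne
    refine hsingle v hvE hvS ?_
    rcases hor with h | h
    · omega
    · have : (B ∩ {v}).card = 1 := by
        rw [Finset.inter_singleton_of_mem h, Finset.card_singleton]
      omega
  · obtain ⟨T, hvT, hblock, hdis, hle⟩ := exists_block hΔ hSE hadj hvE hvC hvS
    have := hT T hvT hblock hdis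
    exact hgrow T (fun x hx => (hblock.1 x hx).1) ⟨v, hvT⟩ hdis (by omega)

end Counting

end Pebbling

namespace Pebbling

/-! ### Cutting and gluing flows along one edge -/

section Glue

open Classical

variable {V : Type*} [Fintype V]

/-- The moves of `f` inside `T`. -/
noncomputable def inside (T : Finset V) (f : V → V → ℕ) : V → V → ℕ :=
  fun a b => if a ∈ T ∧ b ∈ T then f a b else 0

variable {G : SimpleGraph V} {Q : Distribution V} {f g h : V → V → ℕ} {T W : Finset V}

theorem inside_le {V : Type*} (T : Finset V) (f : V → V → ℕ) : inside T f ≤ f := by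
  intro a b
  by_cases h : a ∈ T ∧ b ∈ T <;> simp [inside, h]

theorem inflow_inside_of_notMem {a : V} (ha : a ∉ T) : inflow (inside T f) a = 0 := by
  simp [inflow, inside, ha]

theorem outflow_inside_of_notMem {a : V} (ha : a ∉ T) : outflow (inside T f) a = 0 := by
  simp [outflow, inside, ha]

theorem inflow_inside {w x : V} (hw : w ∉ T) (hx : x ∈ T)
    (hin : ∀ a, a ∉ T → ∀ b ∈ T, 0 < f a b → a = w ∧ b = x) {a : V} (ha : a ∈ T) :
    inflow f a = inflow (inside T f) a + if a = x then f w x else 0 := by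
  have : ∀ b, f b a = inside T f b a + if b = w then (if a = x then f w x else 0) else 0 := by
    intro b
    by_cases hb : b ∈ T
    · have : b ≠ w := fun h => hw (h ▸ hb)
      simp [inside, hb, ha, this]
    · by_cases hbw : b = w ∧ a = x
      · obtain ⟨rfl, rfl⟩ := hbw
        simp [inside, hb]
      · have h0 : f b a = 0 := by
          by_contra h
          exact hbw (hin b hb a ha (Nat.pos_of_ne_zero h))
        by_cases h1 : b = w
        · have h2 : a ≠ x := fun h => hbw ⟨h1, h⟩
          simp [inside, hb, h0, h2]
        · simp [inside, hb, h0, h1]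
  unfold inflow
  rw [Finset.sum_congr rfl fun b _ => this b, Finset.sum_add_distrib]
  simp

theorem inflow_inside_of_closed {a : V} (hin : ∀ b, b ∉ T → f b a = 0) (ha : a ∈ T) :
    inflow f a = inflow (inside T f) a := by
  refine Finset.sum_congr rfl fun b _ => ?_
  by_cases hb : b ∈ T
  · simp [inside, hb, ha]
  · simp [inside, hb, hin b hb]

theorem outflow_inside_add_le (f : V → V → ℕ) {w x : V} (hw : w ∉ T) (a : V) :
    outflow (inside T f) a + (if a = x then f x w else 0) ≤ outflow f a := by
  by_cases hax : a = x
  · subst hax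
    rw [if_pos rfl]
    have : ∀ b, inside T f a b + (if b = w then f a w else 0) ≤ f a b := by
      intro b
      by_cases hb : b = w
      · subst hb
        simp [inside, hw]
      · simpa [hb] using inside_le T f a b
    have := Finset.sum_le_sum fun b (_ : b ∈ Finset.univ) => this b
    rw [Finset.sum_add_distrib] at this
    simpa [outflow] using this
  · rw [if_neg hax, add_zero]
    exact outflow_mono (inside_le T f) a

/-- A set without incoming moves can be considered on its own. -/
theorem IsFlow.le_reach_of_closed {P : Distribution V} (hf : IsFlow G Q f)
    (hin : ∀ a, a ∉ T → ∀ b ∈ T, f a b = 0) (hP : ∀ a ∈ T, Q a = P a) {v : V} (hv : v ∈ T)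
    (hout : outflow f v = 0) : Q v + inflow f v ≤ reach G P v := by
  have hle := inside_le T f
  have hg : IsFlow G P (inside T f) := by
    refine ⟨fun a b hab => hf.adj a b (lt_of_lt_of_le hab (hle a b)), fun a => ?_⟩
    by_cases ha : a ∈ T
    · have h1 := hf.bal a
      have h2 := outflow_mono hle a
      rw [← inflow_inside_of_closed (fun b hb => hin b hb a ha) ha, ← hP a ha]
      omega
    · rw [outflow_inside_of_notMem ha]; omega
  refine hg.le_reach ?_
  have h2 := outflow_mono hle v
  rw [← inflow_inside_of_closed (fun b hb => hin b hb v hv) hv, ← hP v hv]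
  omega

/-- Two flows on disjoint sets can be joined by moves along an edge. -/
theorem isFlow_glue (hdis : Disjoint W T) {x y : V} (hx : x ∈ W)
    (hxy : G.Adj x y) (hg : ∀ a b, 0 < g a b → G.Adj a b) (hh : ∀ a b, 0 < h a b → G.Adj a b)
    {s : ℕ}
    (hbg : ∀ a ∈ W, 2 * outflow (inside W g) a + (if a = x then 2 * s else 0)
      ≤ Q a + inflow (inside W g) a)
    (hbh : ∀ a ∈ T, 2 * outflow (inside T h) a
      ≤ Q a + inflow (inside T h) a + if a = y then s else 0) :
    IsFlow G Q (inside W g + inside T h + edgeFlow x y s) := by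
  refine ⟨fun a b hab => ?_, fun a => ?_⟩
  · by_cases h1 : a = x ∧ b = y
    · rw [h1.1, h1.2]; exact hxy
    by_cases h2 : 0 < inside W g a b
    · exact hg a b (lt_of_lt_of_le h2 (inside_le W g a b))
    by_cases h3 : 0 < inside T h a b
    · exact hh a b (lt_of_lt_of_le h3 (inside_le T h a b))
    simp only [Pi.add_apply, edgeFlow, h1, if_false] at hab
    omega
  · simp only [inflow_add, outflow_add, inflow_edgeFlow, outflow_edgeFlow]
    by_cases haW : a ∈ W
    · have haT : a ∉ T := Finset.disjoint_left.1 hdis haW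
      rw [inflow_inside_of_notMem haT, outflow_inside_of_notMem haT]
      have := hbg a haW
      split_ifs at this ⊢ <;> omega
    · have hax : a ≠ x := fun h => haW (h ▸ hx)
      rw [inflow_inside_of_notMem haW, outflow_inside_of_notMem haW, if_neg hax]
      by_cases haT : a ∈ T
      · have := hbh a haT
        split_ifs at this ⊢ <;> omega
      · rw [outflow_inside_of_notMem haT]; omega

theorem le_reach_of_glue (hdis : Disjoint W T) {x y : V} (hx : x ∈ W)
    (hxy : G.Adj x y) (hg : ∀ a b, 0 < g a b → G.Adj a b) (hh : ∀ a b, 0 < h a b → G.Adj a b)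
    {s : ℕ}
    (hbg : ∀ a ∈ W, 2 * outflow (inside W g) a + (if a = x then 2 * s else 0)
      ≤ Q a + inflow (inside W g) a)
    (hbh : ∀ a ∈ T, 2 * outflow (inside T h) a
      ≤ Q a + inflow (inside T h) a + if a = y then s else 0)
    {v : V} (hv : v ∈ T) {k : ℕ}
    (hk : k + 2 * outflow (inside T h) v
      ≤ Q v + inflow (inside T h) v + if v = y then s else 0) : k ≤ reach G Q v := by
  refine (isFlow_glue hdis hx hxy hg hh hbg hbh).le_reach ?_
  have hvW : v ∉ W := Finset.disjoint_right.1 hdis hv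
  have hvx : v ≠ x := fun h => hvW (h ▸ hx)
  simp only [inflow_add, outflow_add, inflow_edgeFlow, outflow_edgeFlow,
    inflow_inside_of_notMem hvW, outflow_inside_of_notMem hvW, if_neg hvx]
  omega

/-- The moves inside a set that can be entered from `w` to `x` only. -/
theorem IsFlow.inside_bal {w x : V} (hf : IsFlow G Q f) (hw : w ∉ T) (hx : x ∈ T)
    (hin : ∀ a, a ∉ T → ∀ b ∈ T, 0 < f a b → a = w ∧ b = x) {a : V} (ha : a ∈ T) :
    2 * outflow (inside T f) a + (if a = x then 2 * f x w else 0)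
      ≤ Q a + inflow (inside T f) a + if a = x then f w x else 0 := by
  have h1 := hf.bal a
  rw [inflow_inside hw hx hin ha] at h1
  have h2 := outflow_inside_add_le f hw a (x := x)
  split_ifs at * <;> omega

theorem inflow_eq_inflow_inside_compl_add {w x : V} (hw : w ∉ T) (hx : x ∈ T)
    (hwx : ∀ a ∈ T, 0 < f a w → a = x) :
    inflow f w = inflow (inside Tᶜ f) w + f x w := by
  have : ∀ b, f b w = inside Tᶜ f b w + if b = x then f x w else 0 := by
    intro b
    by_cases hb : b ∈ T
    · by_cases hbx : b = x
      · subst hbx; simp [inside, hb]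
      · have : f b w = 0 := by
          by_contra h
          exact hbx (hwx b hb (Nat.pos_of_ne_zero h))
        simp [inside, hb, hbx, this]
    · have : b ≠ x := fun h => hb (h ▸ hx)
      simp [inside, hb, hw, this]
  unfold inflow
  rw [Finset.sum_congr rfl fun b _ => this b, Finset.sum_add_distrib]
  simp

/-- The moves outside a set that is left from `x` to `w` only, if moves into dead ends are
not counted. -/
theorem IsFlow.compl_bal {w x : V} (hf : IsFlow G Q f) (hw : w ∉ T) (hx : x ∈ T)
    (hwx : ∀ a ∈ T, 0 < f a w → a = x)
    (hdead : ∀ a, a ∉ T → a ≠ w → outflow f a ≠ 0 → ∀ b ∈ T, f b a = 0) {a : V} (ha : a ∉ T) :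
    2 * outflow (inside Tᶜ f) a + (if a = w then 2 * f w x else 0)
      ≤ Q a + inflow (inside Tᶜ f) a + if a = w then f x w else 0 := by
  have hxc : x ∉ Tᶜ := by simpa using hx
  have haT : a ∈ Tᶜ := by simpa using ha
  have h1 := hf.bal a
  have h2 := outflow_inside_add_le f hxc a (x := w)
  by_cases haw : a = w
  · subst haw
    have h3 := inflow_eq_inflow_inside_compl_add hw hx hwx
    simp only [if_true] at *
    omega
  · have hd := hdead a ha haw
    simp only [haw, if_false] at *
    by_cases h0 : outflow f a = 0
    · omega
    · rw [inflow_inside_of_closed (T := Tᶜ)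
        (fun b hb => hd h0 b (by simpa using hb)) haT] at h1
      omega

end Glue

end Pebbling

namespace Pebbling

/-! ### Gaining vertices and the entry into a block -/

section Gain

open Classical

variable {V : Type*} [Fintype V]

/-- The least value of `reach G (P + U) v` for which the excess of `v` under `P + U` is greater
than the sum of the excesses under `P` and under `U`. -/
noncomputable def gainThreshold (G : SimpleGraph V) (P U : Distribution V) (v : V) : ℕ :=
  max (reach G P v) 1 + max (reach G U v) 1

/-- The vertices that contribute to the cooperation excess. -/
noncomputable def gainSet (G : SimpleGraph V) (P U : Distribution V) : Finset V :=
  Finset.univ.filter fun v => gainThreshold G P U v ≤ reach G (P + U) v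

/-- The cooperation vertices. -/
noncomputable def coopSet (G : SimpleGraph V) (P U : Distribution V) : Finset V :=
  Finset.univ.filter (IsCooperationVertex G P U)

/-- The double covered vertices. -/
noncomputable def doubleSet (G : SimpleGraph V) (P U : Distribution V) : Finset V :=
  Finset.univ.filter (IsDoubleCovered G P U)

variable {G : SimpleGraph V} {P U : Distribution V} {u v : V}

theorem mem_gainSet : v ∈ gainSet G P U ↔ gainThreshold G P U v ≤ reach G (P + U) v := by
  simp [gainSet]

theorem mem_coopSet : v ∈ coopSet G P U ↔
    reach G P v = 0 ∧ reach G U v = 0 ∧ 1 ≤ reach G (P + U) v := by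
  simp [coopSet, IsCooperationVertex, reachable_iff]

theorem mem_doubleSet : v ∈ doubleSet G P U ↔ 1 ≤ reach G P v ∧ 1 ≤ reach G U v := by
  simp [doubleSet, IsDoubleCovered, reachable_iff]

theorem doubleSet_subset_gainSet : doubleSet G P U ⊆ gainSet G P U := by
  intro v hv
  rw [mem_doubleSet] at hv
  rw [mem_gainSet, gainThreshold]
  have := reach_add_le G P U v
  omega

theorem notMem_coopSet_of_mem_doubleSet (h : v ∈ doubleSet G P U) : v ∉ coopSet G P U := by
  rw [mem_doubleSet] at h
  rw [mem_coopSet]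
  omega

theorem IsUnitOn.eq_zero {V : Type*} {U : Distribution V} {u : V} (hU : IsUnitOn U u) {x : V} (hx : x ≠ u) : U x = 0 := by
  by_contra h
  exact hx ((hU x).1 (Nat.pos_of_ne_zero h))

theorem IsUnitOn.size_eq (hU : IsUnitOn U u) : size U = U u :=
  Finset.sum_eq_single u (fun _ _ h => hU.eq_zero h) (by simp)

/-- A flow with `u` as a sink spends no pebble of `U`. -/
theorem IsUnitOn.reach_add_le (hU : IsUnitOn U u) (hPu : P u = 0) :
    reach G (P + U) u ≤ reach G P u + U u := by
  obtain ⟨f, hf, -, h0, hk⟩ := exists_flow_of_le_reach (G := G) (P := P + U) (v := u) le_rfl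
  have hg : IsFlow G P f := by
    refine ⟨hf.adj, fun a => ?_⟩
    by_cases ha : a = u
    · subst ha; omega
    · have := hf.bal a
      rwa [Pi.add_apply, hU.eq_zero ha, add_zero] at this
  have := hg.le_reach (k := inflow f u) (v := u) (by omega)
  rw [Pi.add_apply] at hk
  omega

/-- If the unit gains, then there are two double covered vertices. -/
theorem IsUnitOn.two_le_card_doubleSet (hU : IsUnitOn U u) (hn : 2 ≤ U u) (hPu : P u = 0)
    {T : Finset V} (hT : IsBlock G (gainSet G P U) (coopSet G P U) T) (hu : u ∈ T) :
    2 ≤ (doubleSet G P U ∩ T).card := by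
  have h1 := mem_gainSet.1 (hT.1 u hu).1
  have h2 := hU.reach_add_le (G := G) hPu
  have h3 := le_reach G U u
  rw [gainThreshold] at h1
  -- The threshold is at least `max (reach G P u) 1 + U u`, so `reach G P u = 0` would contradict
  -- `h2`.
  have hPr : 1 ≤ reach G P u := by omega
  obtain ⟨x, hxu, hx⟩ := exists_adj_of_reach_pos hPr hPu
  have h4 := half_reach_le_of_adj (P := U) hxu.symm
  have hxD : x ∈ doubleSet G P U := mem_doubleSet.2 ⟨by omega, by omega⟩
  have huD : u ∈ doubleSet G P U := mem_doubleSet.2 ⟨hPr, by omega⟩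
  have hxT : x ∈ T := hT.2 u hu x hxu.symm (doubleSet_subset_gainSet hxD)
    (notMem_coopSet_of_mem_doubleSet hxD)
  rw [← Finset.card_pair hxu.ne]
  refine Finset.card_le_card fun y hy => ?_
  rcases Finset.mem_insert.1 hy with rfl | hy
  · exact Finset.mem_inter.2 ⟨hxD, hxT⟩
  · rw [Finset.mem_singleton.1 hy]
    exact Finset.mem_inter.2 ⟨huD, hu⟩

theorem eq_and_eq_of_sum_card_lt_two {V : Type*} {T : Finset V} {F : V → Finset V}
    (h : ∑ x ∈ T, (F x).card < 2) {x y a b : V} (hx : x ∈ T) (hy : y ∈ T) (ha : a ∈ F x)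
    (hb : b ∈ F y) : x = y ∧ a = b := by
  rw [← Finset.card_sigma] at h
  have := Finset.card_le_one.1 (Nat.lt_succ_iff.1 h) ⟨x, a⟩
    (Finset.mem_sigma.2 ⟨hx, ha⟩) ⟨y, b⟩ (Finset.mem_sigma.2 ⟨hy, hb⟩)
  simpa using this

/-- Moves that bring a vertex `v` of a block `T` above its threshold, before any other vertex
of the block gets there. -/
structure IsFirstGain (G : SimpleGraph V) (P U : Distribution V) (T : Finset V)
    (f : V → V → ℕ) (v : V) : Prop where
  block : IsBlock G (gainSet G P U) (coopSet G P U) T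
  mem : v ∈ T
  isFlow : IsFlow G (P + U) f
  acyclic : Acyclic f
  outflow_eq : outflow f v = 0
  threshold_le : gainThreshold G P U v ≤ (P + U) v + inflow f v
  dead : ∀ c ∈ coopSet G P U, ∀ x ∈ T, G.Adj x c → outflow f c = 0
  lt_threshold : ∀ x ∈ T, 0 < outflow f x → (P + U) x + inflow f x < gainThreshold G P U x

variable {T : Finset V} {f : V → V → ℕ}

/-- The block has to be entered. -/
theorem IsFirstGain.exists_entry (hf : IsFirstGain G P U T f v) (hT : ∀ a ∈ T, U a = 0) :
    ∃ w x, x ∈ T ∧ w ∈ outerNbrs G (gainSet G P U) (coopSet G P U) x ∧ 0 < f w x := by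
  by_contra! hc
  have hin : ∀ a, a ∉ T → ∀ b ∈ T, f a b = 0 := by
    intro a ha b hb
    by_contra h
    have hpos := Nat.pos_of_ne_zero h
    have hab := hf.isFlow.adj a b hpos
    have haC : a ∉ coopSet G P U := fun haC => by
      have := hf.dead a haC b hb hab.symm
      have := le_outflow f a b
      omega
    have haE : a ∉ gainSet G P U := fun haE => ha (hf.block.2 b hb a hab.symm haE haC)
    exact h (Nat.le_zero.1 (hc a b hb (mem_outerNbrs.2 ⟨hab.symm, haE, haC⟩)))
  have h1 := hf.isFlow.le_reach_of_closed (P := P) hin (fun a ha => by simp [hT a ha]) hf.mem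
    hf.outflow_eq
  have h2 := hf.threshold_le
  rw [gainThreshold] at h2
  omega

/-- There are no moves in a set without pebbles that is not entered. -/
theorem IsFlow.eq_zero_of_forall_eq_zero {Q : Distribution V} (hf : IsFlow G Q f)
    (hQ : ∀ a ∈ T, Q a = 0) (hin : ∀ a, a ∉ T → ∀ b ∈ T, f a b = 0) {x : V} (hx : x ∈ T) :
    outflow f x = 0 := by
  have h1 : ∀ a, 2 * outflow (inside T f) a ≤ inflow (inside T f) a := by
    intro a
    by_cases ha : a ∈ T
    · have h1 := hf.bal a
      have h2 := outflow_mono (inside_le T f) a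
      rw [← inflow_inside_of_closed (fun b hb => hin b hb a ha) ha]
      rw [hQ a ha] at h1
      omega
    · rw [outflow_inside_of_notMem ha]; omega
  have h2 : 2 * totalFlow (inside T f) ≤ totalFlow (inside T f) := by
    conv_rhs => rw [totalFlow_eq_sum_inflow]
    rw [totalFlow, Finset.mul_sum]
    exact Finset.sum_le_sum fun a _ => h1 a
  have h3 : inflow (inside T f) x ≤ totalFlow (inside T f) := by
    rw [totalFlow_eq_sum_inflow]
    exact Finset.single_le_sum (fun _ _ => Nat.zero_le _) (Finset.mem_univ x)
  have h4 := hf.bal x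
  rw [hQ x hx, inflow_inside_of_closed (fun b hb => hin b hb x hx) hx] at h4
  omega

/-- The situation in which a block is entered along one edge only. -/
structure IsEntry (G : SimpleGraph V) (P U : Distribution V) (T : Finset V) (w x : V) :
    Prop where
  mem : x ∈ T
  notMem : w ∉ T
  notMem_coopSet : w ∉ coopSet G P U
  adj : G.Adj w x
  unique : ∀ a ∈ T, ∀ b, b ∉ T → b ∉ coopSet G P U → G.Adj a b → a = x ∧ b = w

variable {w x : V}

/-- Cooperation vertices next to `T` send nothing, so every move into `T` uses the one remaining
edge. -/
theorem IsEntry.entry_eq (he : IsEntry G P U T w x) (hf : IsFlow G (P + U) f)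
    (hdead : ∀ c ∈ coopSet G P U, ∀ x ∈ T, G.Adj x c → outflow f c = 0) (a : V) (ha : a ∉ T)
    (b : V) (hb : b ∈ T) (h : 0 < f a b) : a = w ∧ b = x := by
  have hab := hf.adj a b h
  have haC : a ∉ coopSet G P U := fun haC => by
    have := hdead a haC b hb hab.symm
    have := le_outflow f a b
    omega
  exact (he.unique b hb a ha haC hab.symm).symm

/-- Apart from `w`, moves out of `T` end in cooperation vertices that send nothing on; this is the
dead end condition of `IsFlow.compl_bal`. -/
theorem IsEntry.exit_eq (he : IsEntry G P U T w x) (hf : IsFlow G (P + U) f)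
    (hdead : ∀ c ∈ coopSet G P U, ∀ x ∈ T, G.Adj x c → outflow f c = 0) (a : V) (ha : a ∉ T)
    (haw : a ≠ w) (h0 : outflow f a ≠ 0) (b : V) (hb : b ∈ T) : f b a = 0 := by
  by_contra h
  have hba := hf.adj b a (Nat.pos_of_ne_zero h)
  exact haw (he.unique b hb a ha (fun haC => h0 (hdead a haC b hb hba)) hba).2

theorem IsFlow.mono {Q Q' : Distribution V} (hf : IsFlow G Q f) (h : Q ≤ Q') :
    IsFlow G Q' f :=
  ⟨hf.adj, fun a => (hf.bal a).trans (Nat.add_le_add_right (h a) _)⟩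

theorem IsFlow.outflow_eq_zero_of_reach_eq_zero {Q : Distribution V} (hf : IsFlow G Q f)
    (hac : Acyclic f) {c : V} (hc : reach G Q c = 0) : outflow f c = 0 := by
  have h1 := hf.add_inflow_le_reach hac c
  have h2 := hf.bal c
  omega

/-- The entry can not have all its pebbles under `P` alone. -/
theorem IsFirstGain.not_entry_left (hf : IsFirstGain G P U T f v) (he : IsEntry G P U T w x)
    (hT : ∀ a ∈ T, U a = 0) (hs : 0 < f w x) : reach G P w < reach G (P + U) w := by
  by_contra! hle
  obtain ⟨h, hh, hhac, hh0, hhk⟩ :=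
    exists_flow_of_le_reach (G := G) (P := P) (v := w) le_rfl
  have hPQ : P ≤ P + U := fun a => Nat.le_add_right _ _
  have hhQ : IsFlow G (P + U) h := hh.mono hPQ
  have hhd : ∀ c ∈ coopSet G P U, ∀ x ∈ T, G.Adj x c → outflow h c = 0 := fun c hc _ _ _ =>
    hh.outflow_eq_zero_of_reach_eq_zero hhac (mem_coopSet.1 hc).1
  have hfin := he.entry_eq hf.isFlow hf.dead
  have hhin := he.entry_eq hhQ hhd
  have hhwx : h w x = 0 := by
    have := le_outflow h w x
    omega
  have hfxw : f x w = 0 := hf.acyclic.not_pos_symm hs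
  have hadjw : ∀ (g : V → V → ℕ), IsFlow G (P + U) g → ∀ a ∈ T, 0 < g a w → a = x :=
    fun g hg a ha h => (he.unique a ha w he.notMem he.notMem_coopSet (hg.adj a w h)).1
  have hwc : w ∈ Tᶜ := by simpa using he.notMem
  have hdis : Disjoint Tᶜ T := disjoint_compl_left
  -- The question is whether `h`, cut off from `T`, still brings to `w` what `f` spends there on
  -- entering `T`. If so, `h` outside and `f` inside `T` lift `v` to its threshold under `P` alone.
  by_cases hcase : 2 * f w x ≤ P w + inflow (inside Tᶜ h) w
  · have hk : gainThreshold G P U v ≤ reach G P v := by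
      refine le_reach_of_glue hdis hwc he.adj hh.adj hf.isFlow.adj (s := f w x) (fun a ha => ?_)
        (fun a ha => ?_) hf.mem ?_
      · have haT : a ∉ T := by simpa using ha
        have h1 := hh.compl_bal he.notMem he.mem (hadjw h hhQ) (he.exit_eq hhQ hhd) haT
        by_cases haw : a = w
        · subst haw
          have := outflow_mono (inside_le Tᶜ h) a
          rw [if_pos rfl]
          omega
        · simpa [haw] using h1
      · have h1 := hf.isFlow.inside_bal he.notMem he.mem hfin ha
        rw [Pi.add_apply, hT a ha, hfxw] at h1
        split_ifs at h1 ⊢ <;> omega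
      · have h1 := hf.threshold_le
        have h2 := outflow_mono (inside_le T f) v
        rw [inflow_inside he.notMem he.mem hfin hf.mem, Pi.add_apply, hT v hf.mem] at h1
        rw [hf.outflow_eq] at h2
        split_ifs at h1 ⊢ <;> omega
    rw [gainThreshold] at hk
    omega
  · have hinw : inflow h w = inflow (inside Tᶜ h) w + h x w :=
      inflow_eq_inflow_inside_compl_add he.notMem he.mem (hadjw h hhQ)
    -- Otherwise the halves are exchanged: `f` outside `T` brings more to `w` than `h` does, and `h`
    -- inside `T` still adds `h x w`, so `w` exceeds `reach G P w`.
    have hk : 2 * f w x + h x w ≤ reach G (P + U) w := by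
      refine le_reach_of_glue hdis.symm he.mem he.adj.symm hh.adj hf.isFlow.adj (s := h x w)
        (fun a ha => ?_) (fun a ha => ?_) hwc ?_
      · have h1 := hhQ.inside_bal he.notMem he.mem hhin ha
        rw [hhwx] at h1
        split_ifs at h1 ⊢ <;> omega
      · have h1 := hf.isFlow.compl_bal he.notMem he.mem (hadjw f hf.isFlow)
          (he.exit_eq hf.isFlow hf.dead) (a := a) (by simpa using ha)
        rw [hfxw] at h1
        split_ifs at h1 ⊢ <;> omega
      · have h1 := hf.isFlow.compl_bal he.notMem he.mem (hadjw f hf.isFlow)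
          (he.exit_eq hf.isFlow hf.dead) (a := w) he.notMem
        rw [hfxw] at h1
        simp only [if_true] at h1 ⊢
        omega
    omega

/-- The entry can not have all its pebbles under `U` alone. -/
theorem IsFirstGain.not_entry_right (hf : IsFirstGain G P U T f v) (he : IsEntry G P U T w x)
    (hT : ∀ a ∈ T, U a = 0) (hs : 0 < f w x) (hD : Disjoint (doubleSet G P U) T) :
    reach G U w < reach G (P + U) w := by
  by_contra! hle
  have hfin := he.entry_eq hf.isFlow hf.dead
  -- A gaining vertex that is neither a cooperation vertex nor double covered is reached by exactly
  -- one of `P` and `U`.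
  have htype : ∀ a ∈ T, (reach G P a = 0 ∧ 1 ≤ reach G U a) ∨
      (1 ≤ reach G P a ∧ reach G U a = 0) := by
    intro a ha
    have h1 := fun h => Finset.disjoint_right.1 hD ha (mem_doubleSet.2 h)
    have h2 := fun h => (hf.block.1 a ha).2 (mem_coopSet.2 h)
    have h3 := mem_gainSet.1 (hf.block.1 a ha).1
    rw [gainThreshold] at h3
    by_contra hc
    by_cases hp : 1 ≤ reach G P a <;> by_cases hq : 1 ≤ reach G U a <;>
      simp_all
  have htot : ∀ a b, 0 < f a b → 2 * f a b ≤ (P + U) a + inflow f a := by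
    intro a b _
    have h1 := hf.isFlow.bal a
    have h2 := le_outflow f a b
    omega
  -- A sender has two pebbles but is below its threshold, so the distribution that reaches it
  -- provides two pebbles alone and also reaches the target.
  have hsame : ∀ a ∈ T, ∀ b ∈ T, 0 < f a b → (reach G P a = 0 ↔ reach G P b = 0) := by
    intro a ha b hb hab
    have h1 := htot a b hab
    have h2 := hf.lt_threshold a ha (lt_of_lt_of_le hab (le_outflow f a b))
    have h3 := half_reach_le_of_adj (P := P) (hf.isFlow.adj a b hab)
    have h4 := half_reach_le_of_adj (P := U) (hf.isFlow.adj a b hab)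
    have h5 := htype a ha
    have h6 := htype b hb
    rw [gainThreshold] at h2
    omega
  have hqw : 2 * f w x ≤ reach G U w :=
    (htot w x hs).trans ((hf.isFlow.add_inflow_le_reach hf.acyclic w).trans hle)
  have hqx : 1 ≤ reach G U x := by
    have := half_reach_le_of_adj (P := U) he.adj
    omega
  have hpx : reach G P x = 0 := by
    have := htype x he.mem
    omega
  have hthr := hf.threshold_le
  rw [gainThreshold] at hthr
  by_cases hv : reach G P v = 0
  -- If `v` is reached by `U`, the moves of `f` in this part of `T` use no pebbles of `P` and can be
  -- fed by a `U`-flow to `w`.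
  · let W := T.filter fun a => reach G P a = 0
    have hWT : W ⊆ T := Finset.filter_subset _ _
    have hvW : v ∈ W := Finset.mem_filter.2 ⟨hf.mem, hv⟩
    have hxW : x ∈ W := Finset.mem_filter.2 ⟨he.mem, hpx⟩
    have hwW : w ∉ W := fun h => he.notMem (hWT h)
    have hPW : ∀ a ∈ W, P a = 0 := fun a ha => by
      have := le_reach G P a
      have := (Finset.mem_filter.1 ha).2
      omega
    have hfinW : ∀ a, a ∉ W → ∀ b ∈ W, 0 < f a b → a = w ∧ b = x := by
      intro a ha b hb hab
      by_cases haT : a ∈ T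
      · exact absurd (Finset.mem_filter.2 ⟨haT,
          (hsame a haT b (hWT hb) hab).2 (Finset.mem_filter.1 hb).2⟩) ha
      · exact hfin a haT b (hWT hb) hab
    have hfxw : f x w = 0 := hf.acyclic.not_pos_symm hs
    obtain ⟨h, hh, hhac, hh0, hhk⟩ :=
      exists_flow_of_le_reach (G := G) (P := U) (v := w) le_rfl
    have hhQ : IsFlow G (P + U) h := hh.mono fun a => Nat.le_add_left _ _
    have hhd : ∀ c ∈ coopSet G P U, ∀ x ∈ T, G.Adj x c → outflow h c = 0 := fun c hc _ _ _ =>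
      hh.outflow_eq_zero_of_reach_eq_zero hhac (mem_coopSet.1 hc).2.1
    -- `T` has no pebbles of `U`, and `h` cannot enter it because `w` is its sink.
    have hhT : ∀ a ∈ T, outflow h a = 0 := by
      refine fun a ha => hh.eq_zero_of_forall_eq_zero hT (fun a ha b hb => ?_) ha
      by_contra hne
      obtain ⟨rfl, rfl⟩ := he.entry_eq hhQ hhd a ha b hb (Nat.pos_of_ne_zero hne)
      have := le_outflow h a b
      omega
    have hhz : ∀ b ∈ T, ∀ a, h b a = 0 := fun b hb a => by
      have := le_outflow h b a
      have := hhT b hb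
      omega
    have hhin : ∀ a, a ∉ T → inflow h a = inflow (inside Tᶜ h) a := fun a ha =>
      inflow_inside_of_closed (fun b hb => hhz b (by simpa using hb) a) (by simpa using ha)
    have hdis : Disjoint Tᶜ W := disjoint_compl_left.mono_right hWT
    have hk : (P + U) v + inflow f v ≤ reach G U v := by
      refine le_reach_of_glue hdis (by simpa using he.notMem) he.adj hh.adj hf.isFlow.adj
        (s := f w x) (fun a ha => ?_) (fun a ha => ?_) hvW ?_
      · have haT : a ∉ T := by simpa using ha
        have h1 := hh.bal a
        have h2 := outflow_mono (inside_le Tᶜ h) a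
        rw [hhin a haT] at h1
        by_cases haw : a = w
        · subst haw
          rw [hhin a haT] at hhk
          rw [if_pos rfl]
          omega
        · rw [if_neg haw]; omega
      · have h1 := hf.isFlow.inside_bal hwW hxW hfinW ha
        rw [Pi.add_apply, hPW a ha, hfxw] at h1
        split_ifs at h1 ⊢ <;> omega
      · have h2 := outflow_mono (inside_le W f) v
        rw [hf.outflow_eq] at h2
        rw [inflow_inside hwW hxW hfinW hvW, Pi.add_apply, hPW v hvW]
        omega
    omega
  -- If `v` is reached by `P`, its part of `T` does not contain `x`, so it is not entered and `P`
  -- alone would suffice.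
  · let W := T.filter fun a => reach G P a ≠ 0
    have hk := hf.isFlow.le_reach_of_closed (P := P) (T := W) (fun a ha b hb => ?_)
      (fun a ha => by simp [hT a (Finset.mem_filter.1 ha).1])
      (Finset.mem_filter.2 ⟨hf.mem, hv⟩) hf.outflow_eq
    · omega
    · by_contra hne
      have hab := Nat.pos_of_ne_zero hne
      obtain ⟨hbT, hb0⟩ := Finset.mem_filter.1 hb
      by_cases haT : a ∈ T
      · exact ha (Finset.mem_filter.2 ⟨haT, fun h => hb0 ((hsame a haT b hbT hab).1 h)⟩)
      · obtain ⟨-, rfl⟩ := hfin a haT b hbT hab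
        exact hb0 hpx

/-- If `u` lies in `T`, there are two double covered vertices. Otherwise `T` must be entered, and a
sum below two leaves one entry `w` and no double covered vertex. As `w` has two pebbles but neither
gains nor is double covered, `P + U` brings it no more than one of `P` and `U` does; both cases are
excluded. -/
theorem IsFirstGain.two_le (hf : IsFirstGain G P U T f v) (hU : IsUnitOn U u) (hn : 2 ≤ U u)
    (hPu : P u = 0) : 2 ≤ (doubleSet G P U ∩ T).card
      + ∑ x ∈ T, (outerNbrs G (gainSet G P U) (coopSet G P U) x).card := by
  by_contra! hlt
  have huT : u ∉ T := fun h => by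
    have := hU.two_le_card_doubleSet hn hPu hf.block h
    omega
  have hT : ∀ a ∈ T, U a = 0 := fun a ha => hU.eq_zero fun h => huT (h ▸ ha)
  obtain ⟨w, x, hx, hw, hs⟩ := hf.exists_entry hT
  have hw' := mem_outerNbrs.1 hw
  have hpos : 1 ≤ ∑ x ∈ T, (outerNbrs G (gainSet G P U) (coopSet G P U) x).card :=
    (Finset.card_pos.2 ⟨w, hw⟩).trans_le
      (Finset.single_le_sum (f := fun x => (outerNbrs G (gainSet G P U) (coopSet G P U) x).card)
        (fun _ _ => Nat.zero_le _) hx)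
  have hD : Disjoint (doubleSet G P U) T := by
    rw [Finset.disjoint_iff_inter_eq_empty, ← Finset.card_eq_zero]
    omega
  have he : IsEntry G P U T w x := by
    refine ⟨hx, fun h => hw'.2.1 (hf.block.1 w h).1, hw'.2.2, hw'.1.symm, ?_⟩
    intro a ha b hb hbC hab
    have hbE : b ∉ gainSet G P U := fun hbE => hb (hf.block.2 a ha b hab hbE hbC)
    exact eq_and_eq_of_sum_card_lt_two (by omega) ha hx (mem_outerNbrs.2 ⟨hab, hbE, hbC⟩) hw
  have h1 := hf.not_entry_left he hT hs
  have h2 := hf.not_entry_right he hT hs hD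
  have h3 : ¬ gainThreshold G P U w ≤ reach G (P + U) w := fun h => hw'.2.1 (mem_gainSet.2 h)
  have h4 : ¬ (1 ≤ reach G P w ∧ 1 ≤ reach G U w) := fun h =>
    hw'.2.1 (doubleSet_subset_gainSet (mem_doubleSet.2 h))
  have h5 := hf.isFlow.bal w
  have h6 := hf.isFlow.add_inflow_le_reach hf.acyclic w
  have h7 := le_outflow f w x
  rw [gainThreshold] at h3
  omega

end Gain

end Pebbling

namespace Pebbling

/-! ### Maximum degree at least three -/

section LargeDegree

open Classical

variable {V : Type*} [Fintype V]

/-- The flow `f` is acyclic and collects `k` pebbles at `v`. -/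
structure Delivers (G : SimpleGraph V) (Q : Distribution V) (f : V → V → ℕ) (v : V) (k : ℕ) :
    Prop where
  isFlow : IsFlow G Q f
  acyclic : Acyclic f
  outflow_eq : outflow f v = 0
  le : k ≤ Q v + inflow f v

variable {G : SimpleGraph V} {P U Q : Distribution V} {u v x : V} {f : V → V → ℕ} {k : ℕ}

theorem exists_delivers (h : k ≤ reach G Q v) : ∃ f, Delivers G Q f v k := by
  obtain ⟨f, h1, h2, h3, h4⟩ := exists_flow_of_le_reach h
  exact ⟨f, h1, h2, h3, h4⟩

/-- Stopping at an intermediate vertex saves moves; every minimality argument below rests on this.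
-/
theorem Delivers.exists_lt (hf : Delivers G Q f v k) (hx : 0 < outflow f x) :
    ∃ g, Delivers G Q g x (Q x + inflow f x) ∧ totalFlow g < totalFlow f := by
  obtain ⟨g, hle, hg, h0, hin, htot, -⟩ := hf.isFlow.exists_to hf.acyclic x
  exact ⟨g, ⟨hg, hf.acyclic.mono hle, h0, by omega⟩, by omega⟩

theorem Delivers.two_mul_le (hf : Delivers G Q f v k) (a b : V) :
    2 * f a b ≤ Q a + inflow f a := by
  have h1 := hf.isFlow.bal a
  have h2 := le_outflow f a b
  omega

theorem Delivers.tot_le (hf : Delivers G Q f v k) (a : V) : Q a + inflow f a ≤ reach G Q a :=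
  hf.isFlow.add_inflow_le_reach hf.acyclic a

theorem gainThreshold_of_mem_coopSet (h : v ∈ coopSet G P U) : gainThreshold G P U v = 2 := by
  rw [mem_coopSet] at h
  rw [gainThreshold, h.1, h.2.1]
  rfl

/-- A neighbour that sends pebbles to a cooperation vertex. -/
theorem Delivers.supplier_of_mem_coopSet (hf : Delivers G (P + U) f v k)
    (hv : v ∈ coopSet G P U) (hx : 0 < f x v) :
    reach G P x ≤ 1 ∧ reach G U x ≤ 1 ∧ gainThreshold G P U x ≤ (P + U) x + inflow f x := by
  have hxv := hf.isFlow.adj x v hx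
  -- Two pebbles at `x` under `P` or under `U` alone would reach `v`, so the threshold of `x` is 2.
  have h1 := half_reach_le_of_adj (P := P) hxv
  have h2 := half_reach_le_of_adj (P := U) hxv
  have h3 := hf.two_mul_le x v
  rw [mem_coopSet] at hv
  rw [gainThreshold]
  omega

theorem eq_zero_of_mem_coopSet (hv : v ∈ coopSet G P U) : (P + U) v = 0 := by
  have h1 := le_reach G P v
  have h2 := le_reach G U v
  rw [mem_coopSet] at hv
  rw [Pi.add_apply]
  omega

/-- A supplier of a cooperation vertex gains. -/
theorem coopSet_subset_covered :
    coopSet G P U ⊆ covered G (gainSet G P U) (coopSet G P U) (gainSet G P U) := by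
  intro c hc
  obtain ⟨f, hf⟩ := exists_delivers (mem_coopSet.1 hc).2.2
  have h0 := eq_zero_of_mem_coopSet hc
  have h1 := hf.le
  obtain ⟨x, hx⟩ := exists_pos_of_inflow_pos (f := f) (v := c) (by omega)
  have hxE : x ∈ gainSet G P U :=
    mem_gainSet.2 ((hf.supplier_of_mem_coopSet hc hx).2.2.trans (hf.tot_le x))
  exact mem_covered.2 ⟨Or.inr hc, Or.inr ⟨x, hxE, hf.isFlow.adj x c hx⟩, fun h => h.2 hc⟩

/-- The moves `f` are the fewest that bring two pebbles to the cooperation vertex `c`, and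
all of these pebbles come from `x`. -/
structure IsSoleSupplier (G : SimpleGraph V) (P U : Distribution V) (x c : V)
    (f : V → V → ℕ) : Prop where
  mem : c ∈ coopSet G P U
  delivers : Delivers G (P + U) f c 2
  min : ∀ g, Delivers G (P + U) g c 2 → totalFlow f ≤ totalFlow g
  eq : ∀ y, 0 < f y c → y = x

/-- The cooperation vertices that get their first two pebbles from `x` only. -/
noncomputable def soleSet (G : SimpleGraph V) (P U : Distribution V) (x : V) : Finset V :=
  Finset.univ.filter fun c => ∃ f, IsSoleSupplier G P U x c f

/-- The vertices of excess at least three without excess under `P` and under `U`. -/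
noncomputable def richSet (G : SimpleGraph V) (P U : Distribution V) : Finset V :=
  Finset.univ.filter fun x =>
    reach G P x ≤ 1 ∧ reach G U x ≤ 1 ∧ 4 ≤ reach G (P + U) x

theorem mem_soleSet {c : V} : c ∈ soleSet G P U x ↔ ∃ f, IsSoleSupplier G P U x c f := by
  simp [soleSet]

theorem IsSoleSupplier.two_le {c : V} (hf : IsSoleSupplier G P U x c f) : 2 ≤ f x c := by
  have h1 := hf.delivers.le
  rw [eq_zero_of_mem_coopSet hf.mem] at h1
  have h2 : inflow f c = f x c := Finset.sum_eq_single x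
    (fun y _ hy => by
      by_contra h
      exact hy (hf.eq y (Nat.pos_of_ne_zero h))) (by simp)
  omega

theorem IsSoleSupplier.mem_richSet {c : V} (hf : IsSoleSupplier G P U x c f) :
    x ∈ richSet G P U := by
  have h1 := hf.two_le
  have h2 := hf.delivers.supplier_of_mem_coopSet hf.mem (x := x) (by omega)
  have h3 := hf.delivers.two_mul_le x c
  have h4 := hf.delivers.tot_le x
  simp only [richSet, Finset.mem_filter, Finset.mem_univ, true_and]
  omega

/-- Take the fewest moves with `x` as sole supplier. As `x` starts with at most one pebble, a
neighbour `y` feeds it. This `y` gets two pebbles with fewer moves, so it is not in the sole set. -/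
theorem card_soleSet_lt {Δ : ℕ} (hΔ : ∀ v, (nbrs G v).card ≤ Δ) (hU : IsUnitOn U u)
    (hPu : P u = 0) (hne : (soleSet G P U x).Nonempty) : (soleSet G P U x).card < Δ := by
  have hex : ∃ n c f, IsSoleSupplier G P U x c f ∧ totalFlow f = n := by
    obtain ⟨c, hc⟩ := hne
    obtain ⟨f, hf⟩ := mem_soleSet.1 hc
    exact ⟨_, c, f, hf, rfl⟩
  obtain ⟨c, f, hf, hn⟩ := Nat.find_spec hex
  have hmin := fun m => Nat.find_min hex (m := m)
  have h1 := hf.two_le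
  have h2 := hf.delivers.two_mul_le x c
  have h3 := hf.mem_richSet
  simp only [richSet, Finset.mem_filter, Finset.mem_univ, true_and] at h3
  have h4 : (P + U) x ≤ 1 := by
    have := le_reach G P x
    have := le_reach G U x
    rw [Pi.add_apply]
    by_cases hx : x = u
    · subst hx; omega
    · rw [hU.eq_zero hx]; omega
  obtain ⟨y, hy⟩ := exists_pos_of_inflow_pos (f := f) (v := x) (by omega)
  have hyx := hf.delivers.isFlow.adj y x hy
  have hynot : y ∉ soleSet G P U x := by
    intro hyS
    obtain ⟨f', hf'⟩ := mem_soleSet.1 hyS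
    obtain ⟨g, hg, hlt⟩ := hf.delivers.exists_lt (lt_of_lt_of_le hy (le_outflow f y x))
    have h5 := hf.delivers.two_mul_le y x
    have h6 := hf'.min g ⟨hg.isFlow, hg.acyclic, hg.outflow_eq, by have := hg.le; omega⟩
    exact hmin (totalFlow f') (by omega) ⟨y, f', hf', rfl⟩
  have hsub : soleSet G P U x ⊆ (nbrs G x).erase y := by
    intro c' hc'
    obtain ⟨f', hf'⟩ := mem_soleSet.1 hc'
    refine Finset.mem_erase.2 ⟨fun h => hynot (h ▸ hc'), mem_nbrs.2 ?_⟩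
    exact hf'.delivers.isFlow.adj x c' (by have := hf'.two_le; omega)
  have h5 := Finset.card_le_card hsub
  have hymem : y ∈ nbrs G x := mem_nbrs.2 hyx.symm
  rw [Finset.card_erase_of_mem hymem] at h5
  have h6 := Finset.card_pos.2 ⟨y, hymem⟩
  have h7 := hΔ x
  omega

theorem card_biUnion_soleSet_le {Δ : ℕ} (hΔ : ∀ v, (nbrs G v).card ≤ Δ) (hU : IsUnitOn U u)
    (hPu : P u = 0) :
    (Finset.univ.biUnion (soleSet G P U)).card ≤ (richSet G P U).card * (Δ - 1) := by
  have hsub : Finset.univ.biUnion (soleSet G P U) ⊆ (richSet G P U).biUnion (soleSet G P U) := by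
    intro c hc
    obtain ⟨x, -, hx⟩ := Finset.mem_biUnion.1 hc
    obtain ⟨f, hf⟩ := mem_soleSet.1 hx
    exact Finset.mem_biUnion.2 ⟨x, hf.mem_richSet, hx⟩
  refine (Finset.card_le_card hsub).trans (Finset.card_biUnion_le_card_mul _ _ _ fun x _ => ?_)
  rcases Finset.eq_empty_or_nonempty (soleSet G P U x) with h | h
  · simp [h]
  · have := card_soleSet_lt hΔ hU hPu h
    omega

/-- The next vertex is always one whose threshold is reached with the fewest moves among those of
the gain set outside `S`. Then senders outside `S` are still below their thresholds. -/
theorem card_coopSet_add_le {Δ : ℕ} (hΔ : ∀ v, (nbrs G v).card ≤ Δ) (hU : IsUnitOn U u)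
    (hn : 2 ≤ U u) (hPu : P u = 0) :
    (coopSet G P U).card + 2 * (gainSet G P U).card
      ≤ Δ * (gainSet G P U).card + (doubleSet G P U).card
        + (Finset.univ.biUnion (soleSet G P U)).card := by
  have hstep := card_covered_le (G := G) (E := gainSet G P U) (C := coopSet G P U)
    (doubleSet G P U) (Finset.univ.biUnion (soleSet G P U)) hΔ ?_
  · have h1 := Finset.card_le_card (coopSet_subset_covered (G := G) (P := P) (U := U))
    have h2 := Finset.card_le_card
      (Finset.inter_subset_left (s₁ := doubleSet G P U) (s₂ := gainSet G P U))
    have h3 := Finset.card_le_card (Finset.inter_subset_left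
      (s₁ := Finset.univ.biUnion (soleSet G P U)) (s₂ := gainSet G P U))
    omega
  intro S hSE hne hS
  have hex : ∃ n v f, v ∈ gainSet G P U ∧ v ∉ S ∧
      Delivers G (P + U) f v (gainThreshold G P U v) ∧ totalFlow f = n := by
    obtain ⟨v, hvE, hvS⟩ := Finset.exists_of_ssubset (hSE.ssubset_of_ne hne)
    obtain ⟨f, hf⟩ := exists_delivers (mem_gainSet.1 hvE)
    exact ⟨_, v, f, hvE, hvS, hf, rfl⟩
  obtain ⟨v, f, hvE, hvS, hf, hntot⟩ := Nat.find_spec hex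
  have hmin := fun m => Nat.find_min hex (m := m)
  have hfirst : ∀ x, x ∉ S → 0 < outflow f x →
      (P + U) x + inflow f x < gainThreshold G P U x := by
    intro x hxS hx
    by_contra! hle
    obtain ⟨g, hg, hlt⟩ := hf.exists_lt hx
    exact hmin (totalFlow g) (by omega) ⟨x, g, mem_gainSet.2 (hle.trans (hf.tot_le x)), hxS,
      ⟨hg.isFlow, hg.acyclic, hg.outflow_eq, hle.trans hg.le⟩, rfl⟩
  refine ⟨v, hvE, hvS, ?_⟩
  by_cases hvC : v ∈ coopSet G P U
  · have hthr := gainThreshold_of_mem_coopSet hvC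
    have hle := hf.le
    rw [hthr, eq_zero_of_mem_coopSet hvC] at hle
    -- A supplier of a cooperation vertex is at its threshold, so `hfirst` puts it into `S`.
    have hA : (Finset.univ.filter fun x => 0 < f x v) ⊆ nbrs G v ∩ S := by
      intro x hx
      have hx0 := (Finset.mem_filter.1 hx).2
      refine Finset.mem_inter.2 ⟨mem_nbrs.2 (hf.isFlow.adj x v hx0).symm, ?_⟩
      by_contra hxS
      have h1 := hfirst x hxS (lt_of_lt_of_le hx0 (le_outflow f x v))
      have h2 := (hf.supplier_of_mem_coopSet hvC hx0).2.2
      omega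
    obtain ⟨x, hx⟩ := exists_pos_of_inflow_pos (f := f) (v := v) (by omega)
    have hxA : x ∈ Finset.univ.filter fun x => 0 < f x v := by simpa using hx
    refine Or.inl ⟨hvC, _, hA, ⟨x, hxA⟩, ?_⟩
    by_contra! hc
    refine hc.2 (Finset.mem_biUnion.2 ⟨x, Finset.mem_univ x, mem_soleSet.2 ⟨f, hvC,
      ⟨hf.isFlow, hf.acyclic, hf.outflow_eq, hthr ▸ hf.le⟩, fun g hg => ?_, fun y hy => ?_⟩⟩)
    · by_contra! hlt
      exact hmin (totalFlow g) (by omega) ⟨v, g, hvE, hvS, hthr.symm ▸ hg, rfl⟩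
    · exact Finset.card_le_one.1 (Nat.lt_succ_iff.1 hc.1) y (by simpa using hy) x hxA
  · refine Or.inr ⟨hvC, fun T hvT hT hdis => ?_⟩
    refine IsFirstGain.two_le (f := f) (v := v) ⟨hT, hvT, hf.isFlow, hf.acyclic, hf.outflow_eq,
      hf.le, fun c hc x hx hxc => ?_,
      fun x hx h => hfirst x (Finset.disjoint_right.1 hdis hx) h⟩ hU hn hPu
    -- By `hS` no vertex of `S` is adjacent to `T`. Outside `S`, sending would need two pebbles at
    -- `c`, which is already its threshold.
    have hcS : c ∉ S := fun hcS =>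
      hS x (hT.1 x hx).1 (hT.1 x hx).2 (Finset.disjoint_right.1 hdis hx) c hcS hxc.symm
    by_contra h0
    have h1 := hfirst c hcS (Nat.pos_of_ne_zero h0)
    have h2 := hf.isFlow.bal c
    rw [gainThreshold_of_mem_coopSet hc] at h1
    omega

theorem coopExcess_eq_sum (G : SimpleGraph V) (P U : Distribution V) :
    coopExcess G P U = ∑ v, ((max (reach G (P + U) v) 1 : ℕ) + 1
      - (gainThreshold G P U v : ℕ) : ℤ) := by
  simp only [coopExcess, totalExcess, exc_eq]
  rw [← Finset.sum_add_distrib, ← Finset.sum_sub_distrib]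
  refine Finset.sum_congr rfl fun v _ => ?_
  rw [gainThreshold]
  push_cast
  ring

/-- The local terms are nonnegative by superadditivity of `reach`; a rich vertex has threshold 2 and
at least four pebbles, which gives 3. -/
theorem le_coopExcess (G : SimpleGraph V) (P U : Distribution V) :
    ((gainSet G P U).card : ℤ) + 2 * (richSet G P U).card ≤ coopExcess G P U := by
  rw [coopExcess_eq_sum, gainSet, richSet, Finset.card_filter, Finset.card_filter]
  push_cast
  rw [Finset.mul_sum, ← Finset.sum_add_distrib]
  refine Finset.sum_le_sum fun v _ => ?_
  have := reach_add_le G P U v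
  unfold gainThreshold
  split_ifs <;> omega

theorem coop_eq_card (G : SimpleGraph V) (P U : Distribution V) :
    coop G P U = (coopSet G P U).card := by
  rw [coop, ← Set.ncard_coe_finset, coopSet]
  congr 1
  ext v
  simp

theorem doubleCovered_eq_card (G : SimpleGraph V) (P U : Distribution V) :
    doubleCovered G P U = (doubleSet G P U).card := by
  rw [doubleCovered, ← Set.ncard_coe_finset, doubleSet]
  congr 1
  ext v
  simp

theorem coop_sub_doubleCovered_le_of_three_le {Δ : ℕ} (hΔ : ∀ v, (nbrs G v).card ≤ Δ)
    (h3 : 3 ≤ Δ) (hU : IsUnitOn U u) (hn : 2 ≤ U u) (hPu : P u = 0) :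
    (coop G P U : ℤ) - (doubleCovered G P U : ℤ) ≤ ((Δ : ℤ) - 2) * coopExcess G P U := by
  have h1 := card_coopSet_add_le hΔ hU hn hPu (G := G)
  have h2 := card_biUnion_soleSet_le hΔ hU hPu (G := G)
  -- Here Δ ≥ 3 is essential: Δ - 1 ≤ 2(Δ - 2).
  have h4 : (richSet G P U).card * (Δ - 1) ≤ (richSet G P U).card * (2 * (Δ - 2)) :=
    Nat.mul_le_mul_left _ (by omega)
  have h5 := mul_le_mul_of_nonneg_left (le_coopExcess G P U)
    (by omega : (0 : ℤ) ≤ (Δ : ℤ) - 2)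
  rw [coop_eq_card, doubleCovered_eq_card]
  obtain ⟨d, rfl⟩ : ∃ d, Δ = d + 2 := ⟨Δ - 2, by omega⟩
  simp only [Nat.add_sub_cancel] at h4
  push_cast at h5 ⊢
  have h6 : (coopSet G P U).card + 2 * (gainSet G P U).card
      ≤ (d + 2) * (gainSet G P U).card + (doubleSet G P U).card
        + (richSet G P U).card * (2 * d) := by omega
  zify at h6
  nlinarith

end LargeDegree

end Pebbling

namespace Pebbling

/-! ### Halving along a path -/

section ArmArithmetic

/-- The numbers of pebbles that can be collected along a path on which the `i`-th vertex has
`p i` pebbles, if one starts with `c` pebbles. -/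
def pathReach (c : ℕ) (p : ℕ → ℕ) : ℕ → ℕ
  | 0 => c
  | i + 1 => p (i + 1) + pathReach c p i / 2

/-- The positions in `[i, K]` that are not reached along a path. -/
def unreached (c : ℕ) (p : ℕ → ℕ) (i K : ℕ) : Finset ℕ :=
  (Finset.Icc i K).filter fun j => pathReach c p j = 0

variable {a n K : ℕ} {p : ℕ → ℕ}

theorem card_unreached_eq {i : ℕ} (hi : i ≤ K) :
    (unreached a p i K).card
      = (if pathReach a p i = 0 then 1 else 0) + (unreached a p (i + 1) K).card := by
  have : Finset.Icc i K = insert i (Finset.Icc (i + 1) K) := by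
    ext j
    simp only [Finset.mem_insert, Finset.mem_Icc]
    omega
  unfold unreached
  rw [this, Finset.filter_insert]
  split_ifs with h
  · rw [Finset.card_insert_of_notMem (by simp)]
    omega
  · omega

/-- Backwards from `K`: in the difference of the two path values the pebbles of `p` cancel. One step
back at least doubles it at an unreached position, and despite rounding does not decrease it
elsewhere. -/
theorem two_pow_card_unreached_le (hK : pathReach a p K = 0) (hpos : 1 ≤ pathReach (n + a) p K)
    {i : ℕ} (hi : i ≤ K) :
    pathReach a p i + 1 ≤ pathReach (n + a) p i ∧ 1 ≤ (unreached a p i K).card ∧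
      2 ^ (unreached a p i K).card ≤ 2 * (pathReach (n + a) p i - pathReach a p i) := by
  induction hi using Nat.decreasingInduction with
  | self =>
    have : (unreached a p K K).card = 1 := by
      rw [unreached, Finset.Icc_self, Finset.filter_singleton, if_pos hK, Finset.card_singleton]
    rw [this, hK]
    omega
  | of_succ i hi ih =>
    obtain ⟨h1, h2, h3⟩ := ih
    rw [card_unreached_eq hi.le]
    simp only [pathReach] at h1 h3
    by_cases h0 : pathReach a p i = 0
    · rw [if_pos h0, Nat.add_comm 1, pow_succ]
      omega
    · rw [if_neg h0, zero_add]
      omega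

/-- The number of new positions on a path is bounded by the logarithm of the number `n` of
additional pebbles, with one exception. -/
theorem card_unreached_le (hn : 2 ≤ n) (hK : pathReach a p K = 0) (hK0 : 0 < K)
    (hpos : 1 ≤ pathReach (n + a) p K) :
    2 ^ (unreached a p 1 K).card ≤ n ∨
      (0 < a ∧ pathReach a p 1 = 0 ∧ 2 ^ (unreached a p 1 K).card ≤ n + 1) := by
  obtain ⟨h1, h2, h3⟩ := two_pow_card_unreached_le hK hpos (i := 1) hK0
  by_cases h0 : pathReach a p 1 = 0
  · simp only [pathReach] at h1 h3 h0
    simp only [pathReach]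
    -- For odd `a` the additional pebbles also rescue the pebble that halving `a` wastes, hence `n +
    -- 1`.
    rcases Nat.even_or_odd' a with ⟨b, rfl | rfl⟩ <;> omega
  · left
    have hK1 : 1 ≠ K := fun h => h0 (h ▸ hK)
    -- Position 1 does not count, and the estimate at position 2 has a further halving to absorb the
    -- rounding.
    obtain ⟨h4, h5, h6⟩ := two_pow_card_unreached_le hK hpos (i := 2) (by omega)
    rw [card_unreached_eq hK0, if_neg h0, zero_add] at h3 ⊢
    simp only [pathReach] at h1 h4 h6
    have h7 : (unreached a p 2 K).card = 1 ∨ 2 ≤ (unreached a p 2 K).card := by omega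
    rcases h7 with h7 | h7
    · rw [h7]; simpa using hn
    · have : 2 ^ 2 ≤ 2 ^ (unreached a p 2 K).card := Nat.pow_le_pow_right (by norm_num) h7
      show 2 ^ (unreached a p 2 K).card ≤ n
      omega

end ArmArithmetic

/-! ### Arms: paths of moves from u -/

section Arm

open Classical

variable {V : Type*} [Fintype V] {G : SimpleGraph V}

/-- The vertex after `a`, `b` on a path. -/
noncomputable def nextVertex (G : SimpleGraph V) (a b : V) : V :=
  if h : ∃ c, G.Adj b c ∧ c ≠ a then h.choose else b

/-- The path that starts with `u`, `w`. -/
noncomputable def arm (G : SimpleGraph V) (u w : V) : ℕ → V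
  | 0 => u
  | 1 => w
  | i + 2 => nextVertex G (arm G u w i) (arm G u w (i + 1))

theorem eq_or_eq_of_adj (hΔ : ∀ v, (nbrs G v).card ≤ 2) {v a b c : V} (ha : G.Adj v a)
    (hb : G.Adj v b) (hab : a ≠ b) (hc : G.Adj v c) : c = a ∨ c = b := by
  by_contra! h
  have hsub : ({a, b, c} : Finset V) ⊆ nbrs G v := by
    intro x hx
    simp only [Finset.mem_insert, Finset.mem_singleton] at hx
    rw [mem_nbrs]
    rcases hx with rfl | rfl | rfl <;> assumption
  have h1 := Finset.card_le_card hsub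
  rw [Finset.card_eq_three.2 ⟨a, b, c, hab, h.1.symm, h.2.symm, rfl⟩] at h1
  have := hΔ v
  omega

theorem nextVertex_eq (hΔ : ∀ v, (nbrs G v).card ≤ 2) {a b c : V} (hba : G.Adj b a)
    (hbc : G.Adj b c) (hca : c ≠ a) : nextVertex G a b = c := by
  have h : ∃ c, G.Adj b c ∧ c ≠ a := ⟨c, hbc, hca⟩
  rw [nextVertex, dif_pos h]
  exact (eq_or_eq_of_adj hΔ hba hbc hca.symm h.choose_spec.1).resolve_left h.choose_spec.2

variable {P U : Distribution V} {f : V → V → ℕ} {u w : V} {K : ℕ}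

/-- The moves of `f` go along the first `K` edges of the arm that starts with `u`, `w`. -/
structure IsArm (G : SimpleGraph V) (P U : Distribution V) (f : V → V → ℕ) (u w : V) (K : ℕ) :
    Prop where
  isFlow : IsFlow G (P + U) f
  acyclic : Acyclic f
  pos : 0 < K
  move : ∀ i < K, 0 < f (arm G u w i) (arm G u w (i + 1))

theorem IsArm.adj (h : IsArm G P U f u w K) {i : ℕ} (hi : i < K) :
    G.Adj (arm G u w i) (arm G u w (i + 1)) := h.isFlow.adj _ _ (h.move i hi)

theorem IsArm.transGen (h : IsArm G P U f u w K) {i j : ℕ} (hij : i < j) (hj : j ≤ K) :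
    Relation.TransGen (fun a b => 0 < f a b) (arm G u w i) (arm G u w j) := by
  induction j, hij using Nat.le_induction with
  | base => exact Relation.TransGen.single (h.move i hj)
  | succ j hij ih => exact (ih (by omega)).tail (h.move j hj)

theorem IsArm.ne (h : IsArm G P U f u w K) {i j : ℕ} (hij : i < j) (hj : j ≤ K) :
    arm G u w i ≠ arm G u w j := fun heq =>
  h.acyclic.transGen.irrefl.irrefl _ (heq ▸ h.transGen hij hj)

theorem IsArm.injOn (h : IsArm G P U f u w K) :
    Set.InjOn (arm G u w) (Finset.range (K + 1)) := by
  intro i hi j hj heq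
  simp only [Finset.coe_range, Set.mem_Iio] at hi hj
  by_contra hne
  rcases Nat.lt_or_gt_of_ne hne with hlt | hlt
  · exact h.ne hlt (by omega) heq
  · exact h.ne hlt (by omega) heq.symm

/-- Acyclicity forbids turning back, and with degrees at most two this determines each next vertex.
-/
theorem exists_isArm (hΔ : ∀ v, (nbrs G v).card ≤ 2) (hf : IsFlow G (P + U) f)
    (hac : Acyclic f) {c : V} (h : Relation.TransGen (fun a b => 0 < f a b) u c) :
    ∃ w K, IsArm G P U f u w K ∧ arm G u w K = c := by
  induction h with
  | @single c hc =>
    refine ⟨c, 1, ⟨hf, hac, one_pos, fun i hi => ?_⟩, rfl⟩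
    obtain rfl : i = 0 := by omega
    exact hc
  | @tail b c _ hbc ih =>
    obtain ⟨w, K, hA, rfl⟩ := ih
    have hK := hA.pos
    obtain ⟨k, rfl⟩ : ∃ k, K = k + 1 := ⟨K - 1, by omega⟩
    have hlast := hA.move k (by omega)
    have hne : c ≠ arm G u w k := by
      rintro rfl
      have := hac.not_pos_symm hlast
      omega
    have hc : arm G u w (k + 2) = c :=
      nextVertex_eq hΔ (hf.adj _ _ hlast).symm (hf.adj _ _ hbc) hne
    refine ⟨w, k + 2, ⟨hf, hac, by omega, fun i hi => ?_⟩, hc⟩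
    rcases Nat.lt_succ_iff_lt_or_eq.1 hi with h | rfl
    · exact hA.move i h
    · rw [hc]; exact hbc

/-- If no moves led from `u` to `c`, the vertices leading to `c` would form a set that is not
entered and has no pebbles of `U`; then `P` alone would reach `c`. -/
theorem exists_isArm_of_mem_coopSet (hΔ : ∀ v, (nbrs G v).card ≤ 2) (hU : IsUnitOn U u) {c : V}
    (hc : c ∈ coopSet G P U) : ∃ f w K, IsArm G P U f u w K ∧ arm G u w K = c := by
  obtain ⟨f, hf⟩ := exists_delivers (mem_coopSet.1 hc).2.2
  by_cases h : Relation.TransGen (fun a b => 0 < f a b) u c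
  · obtain ⟨w, K, h1, h2⟩ := exists_isArm hΔ hf.isFlow hf.acyclic h
    exact ⟨f, w, K, h1, h2⟩
  exfalso
  have huc : u ≠ c := by
    rintro rfl
    have h1 := le_reach G U u
    have h2 := (hU u).2 rfl
    rw [mem_coopSet] at hc
    omega
  let T : Finset V := Finset.univ.filter fun a =>
    Relation.ReflTransGen (fun a b => 0 < f a b) a c
  have h1 := hf.isFlow.le_reach_of_closed (P := P) (T := T) (v := c)
    (fun a ha b hb => ?_) (fun a ha => ?_)
    (Finset.mem_filter.2 ⟨Finset.mem_univ _, Relation.ReflTransGen.refl⟩) hf.outflow_eq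
  · have h2 := hf.le
    rw [mem_coopSet] at hc
    omega
  · by_contra hne
    exact ha (Finset.mem_filter.2 ⟨Finset.mem_univ _,
      Relation.ReflTransGen.head (Nat.pos_of_ne_zero hne) (Finset.mem_filter.1 hb).2⟩)
  · have hau : a ≠ u := by
      rintro rfl
      rcases Relation.reflTransGen_iff_eq_or_transGen.1 (Finset.mem_filter.1 ha).2 with h' | h'
      · exact huc h'.symm
      · exact h h'
    simp [hU.eq_zero hau]

/-- The numbers of pebbles on an arm are bounded by those collected along the arm. -/
theorem IsArm.tot_le (hΔ : ∀ v, (nbrs G v).card ≤ 2) (hU : IsUnitOn U u) (hPu : P u = 0)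
    (h : IsArm G P U f u w K) {i : ℕ} (hi : i < K) :
    (P + U) (arm G u w i) + inflow f (arm G u w i)
      ≤ pathReach (U u + inflow f u) (fun j => P (arm G u w j)) i := by
  induction i with
  | zero => simp [arm, pathReach, hPu]
  | succ i ih =>
    have h1 := ih (by omega)
    have h2 := h.isFlow.bal (arm G u w i)
    have h3 := le_outflow f (arm G u w i) (arm G u w (i + 1))
    -- The only other neighbour is the next vertex of the arm, which cannot send back.
    have h4 : inflow f (arm G u w (i + 1)) = f (arm G u w i) (arm G u w (i + 1)) := by
      refine Finset.sum_eq_single _ (fun b _ hb => ?_) (by simp)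
      by_contra hne
      have hb' := h.isFlow.adj _ _ (Nat.pos_of_ne_zero hne)
      rcases eq_or_eq_of_adj hΔ (h.adj (i := i) (by omega)).symm (h.adj hi)
        (h.ne (i := i) (j := i + 2) (by omega) (by omega)) hb'.symm with rfl | rfl
      · exact hb rfl
      · exact hne (h.acyclic.not_pos_symm (h.move (i + 1) hi))
    have h5 : U (arm G u w (i + 1)) = 0 :=
      hU.eq_zero (h.ne (i := 0) (Nat.succ_pos i) hi.le).symm
    rw [h4, Pi.add_apply, h5]
    simp only [pathReach]
    omega

theorem IsArm.one_le_pathReach (hΔ : ∀ v, (nbrs G v).card ≤ 2) (hU : IsUnitOn U u)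
    (hPu : P u = 0) (h : IsArm G P U f u w K) :
    1 ≤ pathReach (U u + inflow f u) (fun j => P (arm G u w j)) K := by
  have hK := h.pos
  obtain ⟨k, rfl⟩ : ∃ k, K = k + 1 := ⟨K - 1, by omega⟩
  have h1 := h.tot_le hΔ hU hPu (i := k) (by omega)
  have h2 := h.isFlow.bal (arm G u w k)
  have h3 := le_outflow f (arm G u w k) (arm G u w (k + 1))
  have h4 := h.move k (by omega)
  simp only [pathReach]
  omega

/-- The pebbles that come to `u` are pebbles of `P`, and they can go on along the arm. -/
theorem IsArm.exists_flow (hU : IsUnitOn U u) (h : IsArm G P U f u w K) :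
    ∃ g, g ≤ f ∧ IsFlow G P g ∧ inflow g u = inflow f u ∧
      ∀ i ≤ K, outflow g (arm G u w i) = 0 := by
  obtain ⟨g, hle, hg, h0, hin, -, hanc⟩ := h.isFlow.exists_to h.acyclic u
  refine ⟨g, hle, ⟨hg.adj, fun a => ?_⟩, hin, fun i hi => ?_⟩
  · by_cases ha : a = u
    · rw [ha, h0]; omega
    · have := hg.bal a
      rwa [Pi.add_apply, hU.eq_zero ha, add_zero] at this
  · rcases Nat.eq_zero_or_pos i with rfl | hpos
    · exact h0
    · by_contra hne
      exact h.acyclic.transGen.irrefl.irrefl u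
        ((h.transGen hpos hi).trans_left (hanc _ (Nat.pos_of_ne_zero hne)))

/-- The flow from `IsArm.exists_flow` makes no moves out of the arm, so its pebbles at `u` can be
pushed on along the arm under `P`. -/
theorem IsArm.pathReach_le (hU : IsUnitOn U u) (h : IsArm G P U f u w K)
    {i : ℕ} (hi : i ≤ K) :
    pathReach (inflow f u) (fun j => P (arm G u w j)) i ≤ reach G P (arm G u w i) := by
  have key : ∃ g, IsFlow G P g ∧ (∀ j, i ≤ j → j ≤ K → outflow g (arm G u w j) = 0) ∧
      pathReach (inflow f u) (fun j => P (arm G u w j)) i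
        ≤ P (arm G u w i) + inflow g (arm G u w i) := by
    induction i with
    | zero =>
      obtain ⟨g, -, hg, hin, hout⟩ := h.exists_flow hU
      refine ⟨g, hg, fun j _ hj => hout j hj, ?_⟩
      simp [arm, pathReach, hin]
    | succ i ih =>
      obtain ⟨g, hg, hout, hle⟩ := ih (by omega)
      let s := pathReach (inflow f u) (fun j => P (arm G u w j)) i / 2
      refine ⟨g + edgeFlow (arm G u w i) (arm G u w (i + 1)) s, ⟨fun a b hab => ?_,
        fun a => ?_⟩, fun j hij hj => ?_, ?_⟩
      · by_cases hc : a = arm G u w i ∧ b = arm G u w (i + 1)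
        · rw [hc.1, hc.2]; exact h.adj hi
        · exact hg.adj a b (by simpa [edgeFlow, hc] using hab)
      · rw [outflow_add, inflow_add, outflow_edgeFlow, inflow_edgeFlow]
        by_cases ha : a = arm G u w i
        · have h0 := hout i le_rfl (by omega)
          rw [← ha] at h0 hle
          rw [if_pos ha, h0]
          omega
        · have := hg.bal a
          rw [if_neg ha]
          omega
      · rw [outflow_add, outflow_edgeFlow, if_neg (h.ne hij hj).symm, hout j (by omega) hj]
      · rw [inflow_add, inflow_edgeFlow, if_pos rfl]
        simp only [pathReach, s]
        omega
  obtain ⟨g, hg, hout, hle⟩ := key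
  exact hg.le_reach (by rw [hout i le_rfl hi]; omega)

/-- If pebbles come to `u`, then they come from a neighbour that is not on the arm. -/
theorem IsArm.exists_adj (hU : IsUnitOn U u) (h : IsArm G P U f u w K)
    (hin : 0 < inflow f u) : ∃ z, z ≠ w ∧ G.Adj u z ∧ 2 ≤ reach G P z := by
  obtain ⟨g, hle, hg, hgin, -⟩ := h.exists_flow hU
  obtain ⟨z, hz⟩ := exists_pos_of_inflow_pos (hgin ▸ hin)
  refine ⟨z, ?_, (hg.adj z u hz).symm, ?_⟩
  · rintro rfl
    have h1 : f z u = 0 := h.acyclic.not_pos_symm (h.move 0 h.pos)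
    have h2 : g z u ≤ f z u := hle z u
    omega
  · have h1 := hg.add_inflow_le_reach (h.acyclic.mono hle) z
    have h2 := hg.bal z
    have h3 := le_outflow g z u
    omega

theorem IsArm.one_le_reach (h : IsArm G P U f u w K) {i : ℕ} (hi : i ≤ K)
    (hn : 2 ^ i ≤ U u) : 1 ≤ reach G U (arm G u w i) := by
  suffices ∀ j ≤ i, 2 ^ (i - j) ≤ reach G U (arm G u w j) by simpa using this i le_rfl
  intro j hj
  induction j with
  | zero => exact hn.trans (le_reach G U u)
  | succ j ih =>
    have h1 := ih (by omega)
    have h2 := half_reach_le_of_adj (P := U) (h.adj (i := j) (by omega))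
    rw [show i - j = i - (j + 1) + 1 by omega, pow_succ] at h1
    omega

end Arm

end Pebbling

namespace Pebbling

/-! ### Maximum degree at most two -/

section SmallDegree

open Classical

variable {V : Type*} [Fintype V] {G : SimpleGraph V} {P U : Distribution V} {u w : V}

/-- The cooperation vertices on the arm that starts with `u`, `w`. -/
noncomputable def armCoops (G : SimpleGraph V) (P U : Distribution V) (u w : V) : Finset V :=
  (coopSet G P U).filter fun c => ∃ f K, IsArm G P U f u w K ∧ arm G u w K = c

/-- The double covered vertices among the first `k` vertices of an arm. -/
noncomputable def armDoubles (G : SimpleGraph V) (P U : Distribution V) (u w : V) (k : ℕ) :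
    Finset V :=
  doubleSet G P U ∩ (Finset.Icc 1 k).image (arm G u w)

theorem IsArm.log_lt {f : V → V → ℕ} {K : ℕ} (hU : IsUnitOn U u) (h : IsArm G P U f u w K)
    (hc : arm G u w K ∈ coopSet G P U) : Nat.log 2 (U u) < K := by
  by_contra! hle
  have hu := (hU u).2 rfl
  have h1 := h.one_le_reach le_rfl
    ((Nat.pow_le_pow_right two_pos hle).trans (Nat.pow_log_le_self 2 hu.ne'))
  rw [mem_coopSet] at hc
  omega

/-- With k = log₂ (U u), `U` reaches positions up to k, so each of 1, …, k is double covered or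
unreached by the pebbles of `P` pushed along the arm. Cooperation vertices lie beyond k and are
unreached too. The bound k on the unreached positions, or k + 1 in the exceptional case, gives the
claim. -/
theorem card_armCoops_le (hΔ : ∀ v, (nbrs G v).card ≤ 2) (hU : IsUnitOn U u) (hn : 2 ≤ U u)
    (hPu : P u = 0) (w : V) :
    (armCoops G P U u w).card ≤ (armDoubles G P U u w (Nat.log 2 (U u))).card ∨
      ((armCoops G P U u w).card ≤ (armDoubles G P U u w (Nat.log 2 (U u))).card + 1 ∧
        u ∈ doubleSet G P U ∧ reach G P w = 0 ∧
        ∃ z, z ≠ w ∧ G.Adj u z ∧ 2 ≤ reach G P z) := by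
  set k := Nat.log 2 (U u) with hk
  rcases Finset.eq_empty_or_nonempty (armCoops G P U u w) with hemp | hne
  · left; simp [hemp]
  have hmem : ∀ c ∈ armCoops G P U u w, ∃ K f, IsArm G P U f u w K ∧ arm G u w K = c := by
    intro c hc
    obtain ⟨f, K, h⟩ := (Finset.mem_filter.1 hc).2
    exact ⟨K, f, h⟩
  choose! κ F hF hκ using hmem
  -- The flow to the farthest cooperation vertex serves for the whole arm.
  obtain ⟨c, hc, hmax⟩ := Finset.exists_max_image _ κ hne
  have hcC := (Finset.mem_filter.1 hc).1
  have hA := hF c hc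
  have hAc := hκ c hc
  generalize κ c = K at *
  generalize F c = f at *
  have hkK : k < K := hA.log_lt hU (hAc ▸ hcC)
  let p : ℕ → ℕ := fun j => P (arm G u w j)
  have hpath : ∀ i ≤ K, pathReach (inflow f u) p i ≤ reach G P (arm G u w i) :=
    fun i hi => hA.pathReach_le hU hi
  have hK0 : pathReach (inflow f u) p K = 0 := by
    have := hpath K le_rfl
    rw [hAc, (mem_coopSet.1 hcC).1] at this
    omega
  let J := unreached (inflow f u) p 1 K
  have hJ := card_unreached_le hn hK0 hA.pos (hA.one_le_pathReach hΔ hU hPu)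
  have hqk : ∀ i ≤ k, 1 ≤ reach G U (arm G u w i) := fun i hi =>
    hA.one_le_reach (by omega)
      ((Nat.pow_le_pow_right two_pos hi).trans (Nat.pow_log_le_self 2 (by omega)))
  let X := (Finset.Icc 1 k).filter fun i => arm G u w i ∈ doubleSet G P U
  have hX : X.card ≤ (armDoubles G P U u w k).card := by
    rw [← Finset.card_image_of_injOn (s := X) (f := arm G u w)]
    · refine Finset.card_le_card fun x hx => ?_
      obtain ⟨i, hi, rfl⟩ := Finset.mem_image.1 hx
      obtain ⟨hi1, hi2⟩ := Finset.mem_filter.1 hi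
      exact Finset.mem_inter.2 ⟨hi2, Finset.mem_image_of_mem _ hi1⟩
    · refine hA.injOn.mono fun i hi => ?_
      have := Finset.mem_Icc.1 (Finset.mem_filter.1 (Finset.mem_coe.1 hi)).1
      simp only [Finset.coe_range, Set.mem_Iio]
      omega
  have hcoop : (armCoops G P U u w).card ≤ (J.filter fun i => ¬ i ≤ k).card := by
    refine (Finset.card_le_card fun c' hc' => ?_).trans
      (Finset.card_image_le (f := arm G u w))
    have hc'C := (Finset.mem_filter.1 hc').1
    have h1 := (hF c' hc').log_lt hU ((hκ c' hc').symm ▸ hc'C)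
    have h2 := hmax c' hc'
    have h3 := hpath _ h2
    rw [hκ c' hc', (mem_coopSet.1 hc'C).1] at h3
    refine Finset.mem_image.2 ⟨κ c', Finset.mem_filter.2 ⟨Finset.mem_filter.2
      ⟨Finset.mem_Icc.2 ⟨by omega, h2⟩, by omega⟩, by omega⟩, hκ c' hc'⟩
  have hsplit := Finset.card_filter_add_card_filter_not (s := J) (fun i => i ≤ k)
  have hcover : Finset.Icc 1 k ⊆ X ∪ J.filter fun i => i ≤ k := by
    intro i hi
    have hi' := Finset.mem_Icc.1 hi
    rw [Finset.mem_union]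
    by_cases h0 : pathReach (inflow f u) p i = 0
    · exact Or.inr (Finset.mem_filter.2
        ⟨Finset.mem_filter.2 ⟨Finset.mem_Icc.2 ⟨hi'.1, by omega⟩, h0⟩, hi'.2⟩)
    · refine Or.inl (Finset.mem_filter.2 ⟨hi, mem_doubleSet.2 ⟨?_, hqk i hi'.2⟩⟩)
      have := hpath i (by omega)
      omega
  have hcard := Finset.card_le_card hcover
  rw [Nat.card_Icc] at hcard
  have hui := Finset.card_union_add_card_inter X (J.filter fun i => i ≤ k)
  rcases hJ with hJ | ⟨ha, hw0, hJ⟩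
  · left
    have : J.card ≤ k := Nat.le_log_of_pow_le one_lt_two hJ
    omega
  · have hJk : J.card ≤ k + 1 := by
      have h1 : U u < 2 ^ (k + 1) := Nat.lt_pow_succ_log_self one_lt_two _
      exact (Nat.pow_le_pow_iff_right one_lt_two).1 (hJ.trans h1)
    by_cases hPw : reach G P w = 0
    · right
      refine ⟨by omega, mem_doubleSet.2 ⟨?_, hqk 0 (Nat.zero_le _)⟩, hPw, hA.exists_adj hU ha⟩
      exact ha.trans_le (hpath 0 (Nat.zero_le _))
    -- Position 1 counts both as double covered and as unreached, which offsets the exception.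
    · left
      have hk1 : 1 ≤ k := Nat.le_log_of_pow_le one_lt_two (by simpa using hn)
      have h1 : 1 ∈ X ∩ J.filter fun i => i ≤ k := by
        refine Finset.mem_inter.2 ⟨Finset.mem_filter.2 ⟨Finset.mem_Icc.2 ⟨le_rfl, hk1⟩,
          mem_doubleSet.2 ⟨Nat.pos_of_ne_zero hPw, hqk 1 hk1⟩⟩,
          Finset.mem_filter.2 ⟨Finset.mem_filter.2 ⟨Finset.mem_Icc.2 ⟨le_rfl, by omega⟩, hw0⟩,
          hk1⟩⟩
      have := Finset.card_pos.2 ⟨1, h1⟩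
      omega

/-- Two arms that both lead to cooperation vertices do not meet near `u`. -/
theorem disjoint_armDoubles (hΔ : ∀ v, (nbrs G v).card ≤ 2) (hU : IsUnitOn U u) {w' : V}
    (hww : w ≠ w') (h : (armCoops G P U u w).Nonempty) (h' : (armCoops G P U u w').Nonempty) :
    Disjoint (armDoubles G P U u w (Nat.log 2 (U u)))
      (armDoubles G P U u w' (Nat.log 2 (U u))) := by
  obtain ⟨c, hc⟩ := h
  obtain ⟨hcC, f, K, hA, rfl⟩ := Finset.mem_filter.1 hc
  obtain ⟨c', hc'⟩ := h'
  obtain ⟨hcC', f', K', hA', rfl⟩ := Finset.mem_filter.1 hc'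
  have hK := hA.log_lt hU hcC
  have hK' := hA'.log_lt hU hcC'
  set k := Nat.log 2 (U u) with hk
  have hu := (hU u).2 rfl
  -- A meeting vertex is interior on the first arm, so the preceding vertex of the second arm lies
  -- there too; descending leads back to `u`.
  have key : ∀ j, 1 ≤ j → j ≤ k → ∀ i, 1 ≤ i → i ≤ K → arm G u w i ≠ arm G u w' j := by
    intro j hj
    induction j, hj using Nat.le_induction with
    | base =>
      intro hjk i hi hiK heq
      obtain ⟨i, rfl⟩ : ∃ m, i = m + 1 := ⟨i - 1, by omega⟩
      have hadj : G.Adj (arm G u w (i + 1)) u := by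
        rw [heq]; exact (hA'.adj (i := 0) (by omega)).symm
      have hi0 : i ≠ 0 := by
        rintro rfl
        exact hww heq
      -- The end of the first arm is a cooperation vertex, whereas the meeting vertex is reached by
      -- `U`.
      have hlt : i + 1 < K := by
        refine lt_of_le_of_ne hiK fun hEq => ?_
        have h1 := hA'.one_le_reach (i := 1) (by omega)
          ((Nat.pow_le_pow_right two_pos hjk).trans (Nat.pow_log_le_self 2 hu.ne'))
        rw [← heq, hEq] at h1
        rw [mem_coopSet] at hcC
        omega
      rcases eq_or_eq_of_adj hΔ (hA.adj (i := i) (by omega)).symm (hA.adj hlt)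
        (hA.ne (i := i) (j := i + 2) (by omega) hlt) hadj with h1 | h1
      · exact hA.ne (i := 0) (j := i) (by omega) (by omega) h1
      · exact hA.ne (i := 0) (j := i + 2) (by omega) hlt h1
    | succ j hj ih =>
      intro hjk i hi hiK heq
      obtain ⟨i, rfl⟩ : ∃ m, i = m + 1 := ⟨i - 1, by omega⟩
      have hadj : G.Adj (arm G u w (i + 1)) (arm G u w' j) := by
        rw [heq]; exact (hA'.adj (i := j) (by omega)).symm
      have hlt : i + 1 < K := by
        refine lt_of_le_of_ne hiK fun hEq => ?_
        have h1 := hA'.one_le_reach (i := j + 1) (by omega)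
          ((Nat.pow_le_pow_right two_pos hjk).trans (Nat.pow_log_le_self 2 hu.ne'))
        rw [← heq, hEq] at h1
        rw [mem_coopSet] at hcC
        omega
      rcases eq_or_eq_of_adj hΔ (hA.adj (i := i) (by omega)).symm (hA.adj hlt)
        (hA.ne (i := i) (j := i + 2) (by omega) hlt) hadj with h1 | h1
      · rcases Nat.eq_zero_or_pos i with rfl | hi0
        · exact hA'.ne (i := 0) (j := j) (by omega) (by omega) h1.symm
        · exact ih (by omega) i hi0 (by omega) h1.symm
      · exact ih (by omega) (i + 2) (by omega) hlt h1.symm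
  refine Finset.disjoint_left.2 fun x hx hx' => ?_
  obtain ⟨i, hi, rfl⟩ := Finset.mem_image.1 (Finset.mem_inter.1 hx).2
  obtain ⟨j, hj, hij⟩ := Finset.mem_image.1 (Finset.mem_inter.1 hx').2
  rw [Finset.mem_Icc] at hi hj
  exact key j hj.1 hj.2 i hi.1 (by omega) hij.symm

theorem notMem_armDoubles (hU : IsUnitOn U u) (h : (armCoops G P U u w).Nonempty) :
    u ∉ armDoubles G P U u w (Nat.log 2 (U u)) := by
  obtain ⟨c, hc⟩ := h
  obtain ⟨hcC, f, K, hA, rfl⟩ := Finset.mem_filter.1 hc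
  have hK := hA.log_lt hU hcC
  intro hu
  obtain ⟨i, hi, hiu⟩ := Finset.mem_image.1 (Finset.mem_inter.1 hu).2
  rw [Finset.mem_Icc] at hi
  exact hA.ne (i := 0) hi.1 (by omega) hiu.symm

/-- At most two arms matter. Their double covered vertices near `u` are disjoint and omit `u`, so
`u` can pay for one exception. -/
theorem card_coopSet_le_of_le_two (hΔ : ∀ v, (nbrs G v).card ≤ 2) (hU : IsUnitOn U u)
    (hn : 2 ≤ U u) (hPu : P u = 0) : (coopSet G P U).card ≤ (doubleSet G P U).card := by
  have hdsub : ∀ w, armDoubles G P U u w (Nat.log 2 (U u)) ⊆ doubleSet G P U :=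
    fun w => Finset.inter_subset_left
  have hbound := card_armCoops_le hΔ hU hn hPu
  have hsingle : ∀ w, (armCoops G P U u w).card ≤ (doubleSet G P U).card := by
    intro w
    rcases Finset.eq_empty_or_nonempty (armCoops G P U u w) with h | h
    · simp [h]
    rcases hbound w with h1 | ⟨h1, h2, -⟩
    · exact h1.trans (Finset.card_le_card (hdsub w))
    · refine h1.trans ?_
      rw [← Finset.card_insert_of_notMem (notMem_armDoubles hU h)]
      exact Finset.card_le_card (Finset.insert_subset h2 (hdsub w))
  have hex : ∀ c ∈ coopSet G P U, ∃ w, G.Adj u w ∧ c ∈ armCoops G P U u w := by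
    intro c hc
    obtain ⟨f, w, K, hA, hAc⟩ := exists_isArm_of_mem_coopSet hΔ hU hc
    exact ⟨w, hA.adj hA.pos, Finset.mem_filter.2 ⟨hc, f, K, hA, hAc⟩⟩
  by_cases htwo : ∃ w w', w ≠ w' ∧ G.Adj u w ∧ G.Adj u w' ∧ (armCoops G P U u w).Nonempty ∧
      (armCoops G P U u w').Nonempty
  · obtain ⟨w, w', hww, hw, hw', hne, hne'⟩ := htwo
    have hsub : coopSet G P U ⊆ armCoops G P U u w ∪ armCoops G P U u w' := by
      intro c hc
      obtain ⟨x, hx, hxc⟩ := hex c hc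
      rw [Finset.mem_union]
      rcases eq_or_eq_of_adj hΔ hw hw' hww hx with rfl | rfl
      · exact Or.inl hxc
      · exact Or.inr hxc
    have h1 := (Finset.card_le_card hsub).trans (Finset.card_union_le _ _)
    have hdis := disjoint_armDoubles hΔ hU hww hne hne'
    have h2 := Finset.card_le_card (Finset.union_subset (hdsub w) (hdsub w'))
    rw [Finset.card_union_of_disjoint hdis] at h2
    have h3 : u ∈ doubleSet G P U → (armDoubles G P U u w (Nat.log 2 (U u))).card
        + (armDoubles G P U u w' (Nat.log 2 (U u))).card + 1 ≤ (doubleSet G P U).card := by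
      intro hu
      have hnot : u ∉ armDoubles G P U u w (Nat.log 2 (U u))
          ∪ armDoubles G P U u w' (Nat.log 2 (U u)) := by
        simp [notMem_armDoubles hU hne, notMem_armDoubles hU hne']
      rw [← Finset.card_union_of_disjoint hdis, ← Finset.card_insert_of_notMem hnot]
      exact Finset.card_le_card
        (Finset.insert_subset hu (Finset.union_subset (hdsub w) (hdsub w')))
    rcases hbound w with ha | ⟨ha, hu, -, z, hz, huz, hz2⟩
    · rcases hbound w' with hb | ⟨hb, hu, -⟩
      · omega
      · have := h3 hu
        omega
    -- An exception on `w` makes pebbles of `P` arrive through `w'`, while one on `w'` makes `w'`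
    -- unreachable under `P`: both cannot occur.
    · have hzw : z = w' := (eq_or_eq_of_adj hΔ hw hw' hww huz).resolve_left hz
      rcases hbound w' with hb | ⟨hb, -, h0, -⟩
      · have := h3 hu
        omega
      · rw [hzw] at hz2
        omega
  · push Not at htwo
    rcases Finset.eq_empty_or_nonempty (coopSet G P U) with h | ⟨c, hc⟩
    · simp [h]
    obtain ⟨w, hw, hcw⟩ := hex c hc
    refine (Finset.card_le_card fun c' hc' => ?_).trans (hsingle w)
    obtain ⟨w', hw', hcw'⟩ := hex c' hc'
    by_cases hww : w = w'
    · exact hww ▸ hcw'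
    · have := htwo w w' hww hw hw' ⟨c, hcw⟩
      rw [this] at hcw'
      simp at hcw'

/-- The only possible supplier receives nothing itself, and its pebbles all belong to `P` or all to
`U`, so halving is additive. -/
theorem reach_add_le_of_le_one (hΔ : ∀ v, (nbrs G v).card ≤ 1) (hU : IsUnitOn U u)
    (hPu : P u = 0) (v : V) : reach G (P + U) v ≤ reach G P v + reach G U v := by
  obtain ⟨f, hf, hac, h0, hk⟩ := exists_flow_of_le_reach (G := G) (P := P + U) (v := v) le_rfl
  have hsum : ∀ x, P x = 0 ∨ U x = 0 := by
    intro x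
    by_cases hx : x = u
    · exact Or.inl (hx ▸ hPu)
    · exact Or.inr (hU.eq_zero hx)
  have huniq : ∀ x a b, G.Adj x a → G.Adj x b → a = b := fun x a b ha hb =>
    Finset.card_le_one.1 (hΔ x) a (mem_nbrs.2 ha) b (mem_nbrs.2 hb)
  by_cases hin : inflow f v = 0
  · have h1 := le_reach G P v
    have h2 := le_reach G U v
    rw [Pi.add_apply] at hk
    omega
  obtain ⟨x, hx⟩ := exists_pos_of_inflow_pos (Nat.pos_of_ne_zero hin)
  have hxv := hf.adj x v hx
  have hfx : f v x = 0 := hac.not_pos_symm hx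
  have hinv : inflow f v = f x v := Finset.sum_eq_single x (fun y _ hy => by
    by_contra hne
    exact hy (huniq v y x (hf.adj y v (Nat.pos_of_ne_zero hne)).symm hxv.symm)) (by simp)
  have hinx : inflow f x = 0 := Finset.sum_eq_zero fun y _ => by
    by_contra hne
    have := huniq x y v (hf.adj y x (Nat.pos_of_ne_zero hne)).symm hxv
    rw [this] at hne
    exact hne hfx
  have hout := hf.bal x
  have hle := le_outflow f x v
  have hmove : ∀ Q : Distribution V, Q v + Q x / 2 ≤ reach G Q v := by
    intro Q
    have hg : IsFlow G Q (edgeFlow x v (Q x / 2)) := by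
      refine ⟨fun a b hab => ?_, fun a => ?_⟩
      · by_cases h : a = x ∧ b = v
        · rw [h.1, h.2]; exact hxv
        · simp [edgeFlow, h] at hab
      · rw [outflow_edgeFlow]
        split_ifs with h
        · rw [h]; omega
        · omega
    refine hg.le_reach ?_
    rw [outflow_edgeFlow, inflow_edgeFlow, if_neg hxv.ne', if_pos rfl]
    omega
  have h1 := hmove P
  have h2 := hmove U
  have h3 := hsum x
  rw [Pi.add_apply] at hk hout
  omega

/-- The factor is negative, so the excess needs an upper bound: subadditivity leaves at most one per
double covered vertex, and there are none if Δ = 0. -/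
theorem coop_sub_doubleCovered_le_of_le_one {Δ : ℕ} (hΔ : ∀ v, (nbrs G v).card ≤ Δ)
    (h1 : Δ ≤ 1) (hU : IsUnitOn U u) (hPu : P u = 0) :
    (coop G P U : ℤ) - (doubleCovered G P U : ℤ) ≤ ((Δ : ℤ) - 2) * coopExcess G P U := by
  have hreach := reach_add_le_of_le_one (fun v => (hΔ v).trans h1) hU hPu
  have hcoop : (coopSet G P U).card = 0 := by
    rw [Finset.card_eq_zero, Finset.eq_empty_iff_forall_notMem]
    intro c hc
    have := hreach c
    rw [mem_coopSet] at hc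
    omega
  have hCE : coopExcess G P U ≤ (doubleSet G P U).card := by
    rw [coopExcess_eq_sum, doubleSet, Finset.card_filter]
    push_cast
    refine Finset.sum_le_sum fun v _ => ?_
    have := hreach v
    simp only [IsDoubleCovered, reachable_iff, gainThreshold]
    split_ifs <;> omega
  rw [coop_eq_card, doubleCovered_eq_card, hcoop]
  interval_cases Δ
  · have hD : (doubleSet G P U).card = 0 := by
      rw [Finset.card_eq_zero, Finset.eq_empty_iff_forall_notMem]
      intro v hv
      have hno : ∀ (Q : Distribution V), Q v = 0 → reach G Q v = 0 := by
        intro Q hQ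
        by_contra hne
        obtain ⟨x, hx, -⟩ := exists_adj_of_reach_pos (Nat.pos_of_ne_zero hne) hQ
        have := Finset.card_pos.2 ⟨x, mem_nbrs.2 hx.symm⟩
        have := hΔ v
        omega
      rw [mem_doubleSet] at hv
      by_cases hvu : v = u
      · have := hno P (hvu ▸ hPu)
        omega
      · have := hno U (hU.eq_zero hvu)
        omega
    rw [hD] at hCE ⊢
    push_cast at hCE ⊢
    linarith
  · push_cast
    linarith

end SmallDegree

end Pebbling

theorem mainTheorem1 {V : Type*} [Fintype V] (G : SimpleGraph V) [DecidableRel G.Adj]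
    (P U : Pebbling.Distribution V) (u : V)
    (hU : Pebbling.IsUnitOn U u) (hsize : 2 ≤ Pebbling.size U) (hPu : P u = 0) :
    (Pebbling.coop G P U : ℤ) - (Pebbling.doubleCovered G P U : ℤ)
      ≤ ((G.maxDegree : ℤ) - 2) * Pebbling.coopExcess G P U := by
  have hn : 2 ≤ U u := hU.size_eq ▸ hsize
  have hΔ : ∀ v, (Pebbling.nbrs G v).card ≤ G.maxDegree := by
    intro v
    convert G.degree_le_maxDegree v using 1
    rw [← G.card_neighborFinset_eq_degree]
    congr 1
    ext x
    simp [Pebbling.mem_nbrs]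
  rcases Nat.lt_trichotomy G.maxDegree 2 with h | h | h
  · exact Pebbling.coop_sub_doubleCovered_le_of_le_one hΔ (by omega) hU hPu
  · rw [h] at hΔ
    have := Pebbling.card_coopSet_le_of_le_two hΔ hU hn hPu
    rw [h, Pebbling.coop_eq_card, Pebbling.doubleCovered_eq_card]
    push_cast
    linarith
  · exact Pebbling.coop_sub_doubleCovered_le_of_three_le hΔ h hU hn hPu
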